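/- **Proposition (Quantum advantage in entanglement detection).** Let $n\ge 2$, $d=n^2$, and let $A,B,R$ be quantum systems of dimension $d_A=d_B=d_R=n=\sqrt d$. Let $\rho=\mathrm{tr}_R|\psi\rangle\langle\psi|\sim\pi_{d,\sqrt d}$ be the random density matrix on $\mathcal H=\mathbb C^n\otimes\mathbb C^n$ (the system $AB$), where $\psi$ is uniformly (Haar) distributed on the unit sphere of $\mathcal H\otimes\mathbb C^n$. Let $\mathcal D(\mathcal H)$ be the set of density matrices, and let $\mathrm{SEP}\subset\mathcal D(\mathcal H)$ be the set of separable states, i.e. the convex hull of the product states $\alpha\otimes\beta$. For observables (Hermitian matrices) $\mathcal O=(O_1,\dots,O_M)$ on $\mathcal H$, the single-copy criterion $\mathcal O$ detects $\rho$ if the feasible region $F_{\mathcal O}(\rho)=\{\sigma\in\mathcal D(\mathcal H):\mathrm{tr}(O_i\sigma)=\mathrm{tr}(O_i\rho),\ i=1,\dots,M\}$ contains no separable state, and its detection capability is $\mathcal C^s(\mathcal O)=\Pr_{\rho\sim\pi_{d,\sqrt d}}[F_{\mathcal O}(\rho)\cap\mathrm{SEP}=\varnothing]$. 1. (Single-copy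 measurements.) There is an absolute constant $c>0$ such that, for every $n\ge2$ and $d=n^2$, every single-copy criterion $\mathcal O$ with $M$ observables and $\mathcal C^s(\mathcal O)>\tfrac12$ satisfies $$M\ \ge\ c\,\frac{\sqrt d}{\ln d}.$$ 2. (One two-copy observable.) Let $\mathbb S_{AB}$ be the operator on $\mathcal H\otimes\mathcal H$ that swaps the two copies of $AB$, and let $\mathbb S_A$ be the operator that swaps only the two copies of $A$. For every $n\ge 2$, the matrix $\mathbb S_{AB}-\mathbb S_A$ is Hermitian and $$\mathrm{tr}\big[(\mathbb S_{AB}-\mathbb S_A)\,\rho\otimes\rho\big]=\mathrm{tr}(\rho^2)-\mathrm{tr}(\rho_A^2),\qquad \rho_A=\mathrm{tr}_B\,\rho,$$ for every matrix $\rho$ on $\mathcal H$; this value is $\le 0$ for every $\rho\in\mathrm{SEP}$ (the purity criterion); and the criterion detects entanglement with capability exactly one half: $$\Pr_{\rho\sim\pi_{d,\sqrt d}}\Big[\mathrm{tr}\big[(\mathbb S_{AB}-\mathbb S_A)\,\rho\otimes\rho\big]>0\Big]=\tfrac12 .$$ -/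

import Mathlib

open MeasureTheory
open scoped Kronecker ComplexOrder

namespace EntDetect

noncomputable section

/-- `Tr_Y`: the partial trace over the second tensor factor of an operator on `ℂ^X ⊗ ℂ^Y`. -/
def partialTraceRight {X Y : Type*} [Fintype Y] (T : Matrix (X × Y) (X × Y) ℂ) : Matrix X X ℂ :=
  fun x x' => ∑ y, T (x, y) (x', y)

/-- The set `𝒟(ℂ^X)` of density matrices. -/
def densityMatrices (X : Type*) [Fintype X] : Set (Matrix X X ℂ) :=
  {ρ | ρ.PosSemidef ∧ ρ.trace = 1}

/-- `SEP`: the separable states of a bipartite system, i.e. the convex mixtures of product states. -/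
def separableStates (A B : Type*) [Fintype A] [Fintype B] : Set (Matrix (A × B) (A × B) ℂ) :=
  convexHull ℝ {σ | ∃ α ∈ densityMatrices A, ∃ β ∈ densityMatrices B, σ = α ⊗ₖ β}

/-- The set of unit vectors (pure states) of the Hilbert space `ℂ^ι`. -/
abbrev PureState (ι : Type*) [Fintype ι] : Type _ :=
  Metric.sphere (0 : EuclideanSpace ℂ ι) 1

/-- The rank-one projection `|ψ⟩⟨ψ|`. -/
def ketbra {ι : Type*} [Fintype ι] (ψ : PureState ι) : Matrix ι ι ℂ :=
  Matrix.vecMulVec (fun i => ψ.1 i) (fun i => star (ψ.1 i))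

/-- The uniform (unitarily invariant) probability measure on the unit vectors of `ℂ^ι`: the
surface measure on the unit sphere that comes from an additive Haar (Lebesgue) measure on `ℂ^ι`,
normalised to have total mass one. -/
def uniformPureState (ι : Type*) [Fintype ι] : Measure (PureState ι) :=
  ((Measure.addHaar : Measure (EuclideanSpace ℂ ι)).toSphere Set.univ)⁻¹ •
    (Measure.addHaar : Measure (EuclideanSpace ℂ ι)).toSphere

/-- Matrices carry the product σ-algebra of their entries. -/
instance matrixMeasurableSpace (X Y : Type*) : MeasurableSpace (Matrix X Y ℂ) :=
  inferInstanceAs (MeasurableSpace (X → Y → ℂ))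

/-- The reduced state `Tr_R |ψ⟩⟨ψ|` on `ℂ^X` of a unit vector `ψ ∈ ℂ^X ⊗ ℂ^R`. -/
def reducedState {X R : Type*} [Fintype X] [Fintype R] (ψ : PureState (X × R)) : Matrix X X ℂ :=
  partialTraceRight (ketbra ψ)

/-- The induced distribution `π_{d,k}`, for `d = |X|` and `k = |R|`: the law of `Tr_R |ψ⟩⟨ψ|` for a
uniformly distributed unit vector `ψ ∈ ℂ^X ⊗ ℂ^R`. -/
def inducedDist (X R : Type*) [Fintype X] [Fintype R] : Measure (Matrix X X ℂ) :=
  (uniformPureState (X × R)).map reducedState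

/-- The feasible region `F_𝒪(ρ)`: all states with the same expectation values as `ρ` for each of
the observables `O i`. -/
def feasibleRegion {X : Type*} [Fintype X] {M : ℕ} (O : Fin M → Matrix X X ℂ) (ρ : Matrix X X ℂ) :
    Set (Matrix X X ℂ) :=
  {σ | σ ∈ densityMatrices X ∧ ∀ i, (O i * σ).trace = (O i * ρ).trace}

/-- The detection capability of the single-copy criterion given by the observables `O i`: the
probability, for `ρ ∼ π_{d,k}` with `d = |A|·|B|` and `k = |R|`, that the feasible region of `ρ`
contains no separable state. -/
def singleCopyCapability {A B : Type*} (R : Type*) [Fintype A] [Fintype B] [Fintype R] {M : ℕ}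
    (O : Fin M → Matrix (A × B) (A × B) ℂ) : ℝ :=
  (inducedDist (A × B) R).real {ρ | feasibleRegion O ρ ∩ separableStates A B = ∅}

/-- `𝕊_{AB}`: the operator on two copies of `ℂ^A ⊗ ℂ^B` that swaps the copies,
`|a,b⟩|a',b'⟩ ↦ |a',b'⟩|a,b⟩`. -/
def swapAB (A B : Type*) [DecidableEq A] [DecidableEq B] :
    Matrix ((A × B) × (A × B)) ((A × B) × (A × B)) ℂ :=
  fun p q => if p = (q.2, q.1) then 1 else 0

/-- `𝕊_A`: the operator on two copies of `ℂ^A ⊗ ℂ^B` that swaps the two `A` systems and leaves the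
`B` systems alone, `|a,b⟩|a',b'⟩ ↦ |a',b⟩|a,b'⟩`. -/
def swapA (A B : Type*) [DecidableEq A] [DecidableEq B] :
    Matrix ((A × B) × (A × B)) ((A × B) × (A × B)) ℂ :=
  fun p q => if p = ((q.2.1, q.1.2), (q.1.1, q.2.2)) then 1 else 0

/-- The two-copy observable `𝕊_{AB} - 𝕊_A`. -/
def purityObservable (A B : Type*) [DecidableEq A] [DecidableEq B] :
    Matrix ((A × B) × (A × B)) ((A × B) × (A × B)) ℂ :=
  swapAB A B - swapA A B

/-- The expectation value `Tr[W (ρ ⊗ ρ)]` of a two-copy observable `W`. -/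
def twoCopyExpectation {X : Type*} [Fintype X] (W : Matrix (X × X) (X × X) ℂ) (ρ : Matrix X X ℂ) :
    ℂ :=
  (W * (ρ ⊗ₖ ρ)).trace

/-- The detection capability of the two-copy criterion "`Tr[W (ρ ⊗ ρ)] ≤ 0` for every separable
`ρ`": the probability, for `ρ ∼ π_{d,k}` with `d = |A|·|B|` and `k = |R|`, that `ρ` violates it. -/
def twoCopyCapability {A B : Type*} (R : Type*) [Fintype A] [Fintype B] [Fintype R]
    (W : Matrix ((A × B) × (A × B)) ((A × B) × (A × B)) ℂ) : ℝ :=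
  (inducedDist (A × B) R).real {ρ | 0 < (twoCopyExpectation W ρ).re}

/-! Helper facts: the measures above are the probability distributions they are meant to be. -/

instance uniformPureState_isProbabilityMeasure (ι : Type*) [Fintype ι] [Nonempty ι] :
    IsProbabilityMeasure (uniformPureState ι) := by
  constructor
  have : NeZero ((Measure.addHaar : Measure (EuclideanSpace ℂ ι)).toSphere) :=
    ⟨Measure.toSphere_ne_zero _⟩
  rw [uniformPureState, Measure.smul_apply, smul_eq_mul]
  exact ENNReal.inv_mul_cancel (NeZero.ne _) (measure_ne_top _ _)

theorem measurable_reducedState {X R : Type*} [Fintype X] [Fintype R] :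
    Measurable (reducedState : PureState (X × R) → Matrix X X ℂ) := by
  have h : ∀ i : X × R, Continuous fun ψ : PureState (X × R) => ψ.1 i := fun i => by fun_prop
  refine measurable_pi_lambda _ fun x => measurable_pi_lambda _ fun x' => ?_
  refine Continuous.measurable ?_
  exact continuous_finsetSum _ fun r _ => (h (x, r)).mul (continuous_star.comp (h (x', r)))

instance inducedDist_isProbabilityMeasure (X R : Type*) [Fintype X] [Fintype R] [Nonempty X]
    [Nonempty R] : IsProbabilityMeasure (inducedDist X R) :=
  Measure.isProbabilityMeasure_map measurable_reducedState.aemeasurable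

end

end EntDetect

/-! Lower bound on `M`. If no separable state is feasible for `ρ`, separating the expectation vector
of `ρ` from the compact convex set of separable expectation vectors yields a witness `W` in the real
span of `1` and the `O i`: block-positive, of trace one, with `tr (Wρ) ≤ 0` (`exists_witness`). Two
facts make a union bound over witnesses work. Block-positivity forces `‖W‖² ≤ 2 (tr W)²` in
Frobenius norm (`IsBlockPositive.norm_sq_le`), so the witnesses form a bounded set in a space of
dimension at most `M + 1` and have a `1/(2d)`-net of at most `(1 + 8d)^(M+1)` points
(`exists_finset_net`). And a single witness succeeds, even with slack `1/(2d)`, with probability at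
most `exp (-n/64)` (`inducedDist_witness_le`): this event lies in `tr (Vρ) ≤ 1` for a positive
definite `V` near `1`, and comparing volumes of cones bounds that probability by `(det V)⁻ⁿ`.
Capability above one half therefore needs `M log n` of order at least `n`.

The two-copy observable. On pairs of product states the polarised form is `tr (αα') (tr (ββ') - 1) ≤
0`; being bilinear, it stays nonpositive on separable pairs, in particular on the diagonal. For the
capability, complementary marginals of a pure state have equal purity, so exchanging `A` and `R`,
which have the same dimension, negates `tr ρ² - tr ρ_A²` (`purityGap_exchange`) and preserves the
uniform measure. Positive and negative values are thus equally likely, and the value zero has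
probability zero because the gap is a nonzero homogeneous real-analytic function
(`addHaar_zeroSet_of_homogeneous`). -/

namespace EntDetect

noncomputable section

open Matrix

/-! ### Frobenius norm, eigenvalues and determinants of Hermitian matrices. -/

section Frobenius

open scoped Matrix.Norms.Frobenius

variable {m n : Type*} [Fintype m] [Fintype n]

theorem frobenius_norm_sq (A : Matrix m n ℂ) : ‖A‖ ^ 2 = ∑ i, ∑ j, ‖A i j‖ ^ 2 := by
  rw [frobenius_norm_def, ← Real.sqrt_eq_rpow, Real.sq_sqrt (by positivity)]
  norm_cast

theorem re_trace_conjTranspose_mul_self (A : Matrix m n ℂ) : (Aᴴ * A).trace.re = ‖A‖ ^ 2 := by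
  rw [frobenius_norm_sq, Finset.sum_comm]
  simp [trace, mul_apply, Complex.sq_norm, Complex.normSq_apply]

theorem IsHermitian.re_trace_mul_self {A : Matrix n n ℂ} (hA : A.IsHermitian) :
    (A * A).trace.re = ‖A‖ ^ 2 := by
  rw [← re_trace_conjTranspose_mul_self, hA.eq]

theorem norm_trace_mul_le (A : Matrix m n ℂ) (B : Matrix n m ℂ) :
    ‖(A * B).trace‖ ≤ ‖A‖ * ‖B‖ := by
  have h1 : ‖(A * B).trace‖ ≤ ∑ p : m × n, ‖A p.1 p.2‖ * ‖B p.2 p.1‖ := by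
    rw [Fintype.sum_prod_type]
    refine (norm_sum_le _ _).trans (Finset.sum_le_sum fun i _ => ?_)
    simp only [diag_apply, mul_apply]
    refine (norm_sum_le _ _).trans (Finset.sum_le_sum fun j _ => ?_)
    rw [norm_mul]
  have h2 := Finset.sum_mul_sq_le_sq_mul_sq Finset.univ (fun p : m × n => ‖A p.1 p.2‖)
    (fun p => ‖B p.2 p.1‖)
  have hB : ∑ p : m × n, ‖B p.2 p.1‖ ^ 2 = ‖B‖ ^ 2 := by
    rw [frobenius_norm_sq, Fintype.sum_prod_type, Finset.sum_comm]
  have hA : ∑ p : m × n, ‖A p.1 p.2‖ ^ 2 = ‖A‖ ^ 2 := by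
    rw [frobenius_norm_sq, Fintype.sum_prod_type]
  rw [hA, hB, ← mul_pow] at h2
  exact h1.trans (abs_le_of_sq_le_sq' h2 (by positivity)).2

theorem exists_conjTranspose_mul_self [DecidableEq n] {A : Matrix n n ℂ} (hA : A.PosSemidef) :
    ∃ B : Matrix n n ℂ, A = Bᴴ * B := by
  open scoped MatrixOrder in
  refine ⟨CFC.sqrt A, ?_⟩
  rw [(CFC.sqrt_nonneg A).posSemidef.1.eq, CFC.sqrt_mul_sqrt_self A hA.nonneg]

theorem IsHermitian.trace_re_eq_sum_eigenvalues [DecidableEq n] {A : Matrix n n ℂ}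
    (hA : A.IsHermitian) : A.trace.re = ∑ i, hA.eigenvalues i := by
  simp [hA.trace_eq_sum_eigenvalues]

theorem IsHermitian.norm_sq_eq_sum_eigenvalues [DecidableEq n] {A : Matrix n n ℂ}
    (hA : A.IsHermitian) : ‖A‖ ^ 2 = ∑ i, hA.eigenvalues i ^ 2 := by
  rw [← re_trace_mul_self hA]
  conv_lhs => rw [hA.spectral_theorem, ← map_mul, Unitary.conjStarAlgAut_apply, trace_mul_cycle,
    Unitary.coe_star_mul_self, one_mul, diagonal_mul_diagonal, trace_diagonal]
  simp [sq]

/-- The eigenbasis evaluation of a matrix has the same trace. -/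
theorem IsHermitian.sum_eigenvectorBasis [DecidableEq n] {A : Matrix n n ℂ}
    (hA : A.IsHermitian) (P : Matrix n n ℂ) :
    ∑ i, star ⇑(hA.eigenvectorBasis i) ⬝ᵥ P *ᵥ ⇑(hA.eigenvectorBasis i) = P.trace := by
  have h : P.trace = (star (hA.eigenvectorUnitary : Matrix n n ℂ) * P *
      (hA.eigenvectorUnitary : Matrix n n ℂ)).trace := by
    rw [trace_mul_cycle, ← Unitary.coe_star, Unitary.coe_mul_star_self, one_mul]
  rw [h, trace]
  refine Finset.sum_congr rfl fun i _ => ?_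
  rw [diag_apply, mul_assoc, mul_apply]
  simp [dotProduct, mulVec, mul_apply, star_apply]

/-- If the numerical values of a Hermitian `H` are dominated by geometric means of those of `P`
and `Q`, then so is its Frobenius norm by the traces. -/
theorem IsHermitian.norm_sq_le_of_sq_le [DecidableEq n] {H P Q : Matrix n n ℂ}
    (hH : H.IsHermitian)
    (hP : ∀ b : n → ℂ, 0 ≤ (star b ⬝ᵥ P *ᵥ b).re) (hQ : ∀ b : n → ℂ, 0 ≤ (star b ⬝ᵥ Q *ᵥ b).re)
    (h : ∀ b : n → ℂ, (star b ⬝ᵥ H *ᵥ b).re ^ 2 ≤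
      (star b ⬝ᵥ P *ᵥ b).re * (star b ⬝ᵥ Q *ᵥ b).re) :
    ‖H‖ ^ 2 ≤ P.trace.re * Q.trace.re := by
  -- In an eigenbasis of `H` the claim reads `∑ λᵢ² ≤ (∑ pᵢ)(∑ qᵢ)`, where `pᵢ`, `qᵢ` are the values
  -- of `P`, `Q`; it follows from `λᵢ² ≤ pᵢ qᵢ` and nonnegativity.
  rw [norm_sq_eq_sum_eigenvalues hH, ← sum_eigenvectorBasis hH P, ← sum_eigenvectorBasis hH Q,
    Complex.re_sum, Complex.re_sum, Finset.sum_mul]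
  refine Finset.sum_le_sum fun i _ => ?_
  rw [hH.eigenvalues_eq]
  refine (h _).trans (mul_le_mul_of_nonneg_left ?_ (hP _))
  exact Finset.single_le_sum (f := fun i => (star ⇑(hH.eigenvectorBasis i) ⬝ᵥ
    Q *ᵥ ⇑(hH.eigenvectorBasis i)).re) (fun i _ => hQ _) (Finset.mem_univ i)

/-- A Hermitian matrix close to the identity has a determinant controlled by its first two
moments. -/
theorem IsHermitian.exp_le_det [DecidableEq n] {V : Matrix n n ℂ} (hV : V.IsHermitian)
    (h : ‖V - 1‖ ^ 2 ≤ 1 / 4) :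
    V.PosDef ∧ Real.exp ((V - 1).trace.re - 2 * ‖V - 1‖ ^ 2) ≤ V.det.re := by
  have hsum : ‖V - 1‖ ^ 2 = ∑ i, (hV.eigenvalues i - 1) ^ 2 := by
    have h1 : (V - 1).IsHermitian := hV.sub isHermitian_one
    rw [← re_trace_mul_self h1]
    have : (V - 1) * (V - 1) = V * V - V - V + 1 := by noncomm_ring
    rw [this, trace_add, trace_sub, trace_sub, Complex.add_re, Complex.sub_re, Complex.sub_re,
      re_trace_mul_self hV, norm_sq_eq_sum_eigenvalues hV, trace_re_eq_sum_eigenvalues hV, trace_one,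
      ← Finset.sum_sub_distrib, ← Finset.sum_sub_distrib]
    simp only [sub_sq, Finset.sum_add_distrib, Finset.sum_sub_distrib, mul_one, ← Finset.mul_sum]
    simp
    ring
  have htr : (V - 1).trace.re = ∑ i, (hV.eigenvalues i - 1) := by
    rw [trace_sub, Complex.sub_re, trace_re_eq_sum_eigenvalues hV, trace_one]
    simp
  have hi : ∀ i, |hV.eigenvalues i - 1| ≤ 1 / 2 := fun i => by
    have : (hV.eigenvalues i - 1) ^ 2 ≤ (1 / 2) ^ 2 := by
      refine (Finset.single_le_sum (f := fun i => (hV.eigenvalues i - 1) ^ 2)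
        (fun i _ => sq_nonneg _) (Finset.mem_univ i)).trans ?_
      rw [← hsum]; linarith
    exact abs_le_of_sq_le_sq this (by norm_num)
  have hpos : ∀ i, 0 < hV.eigenvalues i := fun i => by
    have := abs_le.1 (hi i); linarith
  refine ⟨hV.posDef_iff_eigenvalues_pos.2 hpos, ?_⟩
  have hdet : V.det.re = ∏ i, hV.eigenvalues i := by
    rw [hV.det_eq_prod_eigenvalues]
    norm_cast
  rw [hdet, hsum, htr, Finset.mul_sum, ← Finset.sum_sub_distrib, Real.exp_sum]
  refine Finset.prod_le_prod (fun i _ => (Real.exp_pos _).le) fun i _ => ?_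
  rw [← Real.le_log_iff_exp_le (hpos i)]
  -- It remains to see `x - 2x² ≤ 1 - 1/λ` with `x = λ - 1`. The difference of the two sides is
  -- `x²(2λ - 1)/λ`, nonnegative since `λ ≥ 1/2`.
  refine le_trans ?_ (Real.one_sub_inv_le_log_of_pos (hpos i))
  have h1 := abs_le.1 (hi i)
  have h2 : 1 - (hV.eigenvalues i)⁻¹ - (hV.eigenvalues i - 1 - 2 * (hV.eigenvalues i - 1) ^ 2) =
      (hV.eigenvalues i - 1) ^ 2 * (2 * hV.eigenvalues i - 1) / hV.eigenvalues i := by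
    field_simp [(hpos i).ne']
    ring
  have h3 : 0 ≤ (hV.eigenvalues i - 1) ^ 2 * (2 * hV.eigenvalues i - 1) / hV.eigenvalues i :=
    div_nonneg (mul_nonneg (sq_nonneg _) (by linarith)) (hpos i).le
  linarith

end Frobenius

/-! ### Volume bound for the lower tail of `tr (Vρ)`. -/

section Tail

open scoped Matrix.Norms.Frobenius Pointwise

variable {X R : Type*} [Fintype X] [Fintype R]

/-- The matrix of amplitudes of a pure state of a bipartite system. -/
def amplitudes (ψ : EuclideanSpace ℂ (X × R)) : Matrix X R ℂ := fun x r => ψ (x, r)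

theorem reducedState_eq (ψ : PureState (X × R)) :
    reducedState ψ = amplitudes ψ.1 * (amplitudes ψ.1)ᴴ := by
  ext x x'
  simp [reducedState, partialTraceRight, ketbra, amplitudes, mul_apply, vecMulVec_apply]

theorem norm_amplitudes (ψ : EuclideanSpace ℂ (X × R)) : ‖amplitudes ψ‖ ^ 2 = ‖ψ‖ ^ 2 := by
  rw [frobenius_norm_sq, EuclideanSpace.norm_sq_eq, Fintype.sum_prod_type]
  rfl

theorem reducedState_mem_densityMatrices (ψ : PureState (X × R)) :
    reducedState ψ ∈ densityMatrices X := by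
  rw [reducedState_eq]
  refine ⟨posSemidef_self_mul_conjTranspose _, ?_⟩
  have h1 : ((amplitudes ψ.1 * (amplitudes ψ.1)ᴴ).trace).re = 1 := by
    rw [trace_mul_comm, re_trace_conjTranspose_mul_self, norm_amplitudes]
    simp
  have h2 := (posSemidef_self_mul_conjTranspose (amplitudes ψ.1)).trace_nonneg
  rw [Complex.le_def] at h2
  exact Complex.ext (by simpa using h1) (by simpa using h2.2.symm)

/-- A linear map of determinant `δ` does not contract more than a `δ⁻¹`-fraction of the unit
sphere. -/
theorem uniformPureState_contracted_le {ι : Type*} [Fintype ι] [Nonempty ι]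
    (T : EuclideanSpace ℂ ι →ₗ[ℝ] EuclideanSpace ℂ ι) (hT : LinearMap.det T ≠ 0) :
    uniformPureState ι {ψ | ‖T ψ.1‖ ≤ 1} ≤ ENNReal.ofReal |(LinearMap.det T)⁻¹| := by
  set μ : Measure (EuclideanSpace ℂ ι) := Measure.addHaar
  have hcont : Continuous T := T.continuous_of_finiteDimensional
  have hS : MeasurableSet {ψ : PureState ι | ‖T ψ.1‖ ≤ 1} :=
    (isClosed_le (by fun_prop) continuous_const).measurableSet
  -- The sphere measure of a set is proportional to the volume of the cone over it, and this cone
  -- lies in the preimage of the unit ball under `T`.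
  have hsub : Set.Ioo (0 : ℝ) 1 • ((↑) '' {ψ : PureState ι | ‖T ψ.1‖ ≤ 1}) ⊆
      T ⁻¹' Metric.ball 0 1 := by
    rintro _ ⟨r, hr, _, ⟨ψ, hψ, rfl⟩, rfl⟩
    simp only [Set.mem_preimage, map_smul, mem_ball_zero_iff, norm_smul, Real.norm_eq_abs,
      abs_of_pos hr.1]
    exact (mul_le_of_le_one_right hr.1.le hψ).trans_lt hr.2
  rw [uniformPureState, Measure.smul_apply, smul_eq_mul]
  have h1 : μ.toSphere {ψ | ‖T ψ.1‖ ≤ 1} ≤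
      ENNReal.ofReal |(LinearMap.det T)⁻¹| * μ.toSphere Set.univ := by
    rw [Measure.toSphere_apply' _ hS, Measure.toSphere_apply_univ, mul_left_comm,
      ← Measure.addHaar_preimage_linearMap μ hT]
    gcongr
  have h0 : μ.toSphere Set.univ ≠ 0 := by
    exact fun h => Measure.toSphere_ne_zero μ (Measure.measure_univ_eq_zero.1 h)
  calc _ ≤ (μ.toSphere Set.univ)⁻¹ *
        (ENNReal.ofReal |(LinearMap.det T)⁻¹| * μ.toSphere Set.univ) := by gcongr
    _ = _ := by
      rw [mul_left_comm, ENNReal.inv_mul_cancel h0 (measure_ne_top _ _), mul_one]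

/-- Writing `V = Bᴴ B`, the trace is `‖(B ⊗ 1) ψ‖²`, so the event says that `B ⊗ 1` does not expand
`ψ`. The real determinant of `B ⊗ 1` is the squared modulus of its complex one, `|det B|^(2|R|) =
(det V)^|R|`. -/
theorem uniformPureState_trace_le [DecidableEq X] [DecidableEq R] [Nonempty X] [Nonempty R]
    {V : Matrix X X ℂ} (hV : V.PosDef) :
    uniformPureState (X × R) {ψ | (V * reducedState ψ).trace.re ≤ 1} ≤
      ENNReal.ofReal ((V.det.re ^ Fintype.card R)⁻¹) := by
  obtain ⟨B, hB⟩ := exists_conjTranspose_mul_self hV.posSemidef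
  set T : EuclideanSpace ℂ (X × R) →ₗ[ℂ] EuclideanSpace ℂ (X × R) :=
    Matrix.toLpLin 2 2 (B ⊗ₖ (1 : Matrix R R ℂ)) with hTdef
  have hamp : ∀ ψ, amplitudes (T ψ) = B * amplitudes ψ := fun ψ => by
    ext x r
    simp [amplitudes, hTdef, mul_apply, mulVec, dotProduct, Fintype.sum_prod_type, one_apply]
  have hnorm : ∀ ψ : PureState (X × R), (V * reducedState ψ).trace.re = ‖T ψ.1‖ ^ 2 := fun ψ => by
    rw [← norm_amplitudes, hamp, ← re_trace_conjTranspose_mul_self, reducedState_eq, hB,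
      conjTranspose_mul, ← Matrix.mul_assoc, trace_mul_comm]
    simp only [Matrix.mul_assoc]
  have hdet : LinearMap.det (T.restrictScalars ℝ) = V.det.re ^ Fintype.card R := by
    rw [LinearMap.det_restrictScalars, Algebra.norm_complex_apply, hTdef]
    have h1 : LinearMap.det (Matrix.toLpLin 2 2 (B ⊗ₖ (1 : Matrix R R ℂ))) =
        B.det ^ Fintype.card R := by
      rw [Matrix.toLpLin_eq_toLin, LinearMap.det_toLin, det_kronecker, det_one, one_pow, mul_one]
    rw [h1, map_pow, hB, det_mul, det_conjTranspose]
    congr 1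
    rw [Complex.star_def, ← Complex.normSq_eq_conj_mul_self, Complex.ofReal_re]
  have hpos : 0 < V.det.re := (Complex.lt_def.1 hV.det_pos).1
  have h := uniformPureState_contracted_le (T.restrictScalars ℝ) (by rw [hdet]; positivity)
  rw [hdet, abs_of_pos (by positivity)] at h
  simp only [hnorm, sq_le_one_iff₀ (norm_nonneg _)]
  exact h

end Tail

/-! ### Compact convex hulls and nets in finite dimension. -/

section Convex

/-- In finite dimension the convex hull of a compact set is compact. -/
theorem isCompact_convexHull {E : Type*} [NormedAddCommGroup E] [NormedSpace ℝ E]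
    [FiniteDimensional ℝ E] {s : Set E} (hs : IsCompact s) : IsCompact (convexHull ℝ s) := by
  rcases s.eq_empty_or_nonempty with rfl | ⟨z₀, hz₀⟩
  · simp
  set N := Module.finrank ℝ E + 1
  have hK : IsCompact (stdSimplex ℝ (Fin N) ×ˢ Set.univ.pi fun _ : Fin N => s) :=
    (isCompact_stdSimplex ℝ (Fin N)).prod (isCompact_univ_pi fun _ => hs)
  have hf : Continuous fun p : (Fin N → ℝ) × (Fin N → E) => ∑ i, p.1 i • p.2 i := by fun_prop
  convert hK.image hf using 1
  refine Set.Subset.antisymm (fun x hx => ?_) ?_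
  -- Carathéodory: affinely independent points suffice, hence at most `N` of them. Shorter
  -- combinations are padded to length `N` with weight `0` at the point `z₀`.
  · obtain ⟨ι, _, z, w, hz, hind, hw, hw1, rfl⟩ := eq_pos_convex_span_of_mem_convexHull hx
    have hcard : Fintype.card ι ≤ Fintype.card (Fin N) := by
      rw [Fintype.card_fin]
      exact hind.card_le_finrank_succ.trans (Nat.succ_le_succ (Submodule.finrank_le _))
    obtain ⟨e⟩ := Function.Embedding.nonempty_of_card_le hcard
    have hw' : ∀ i, Function.extend e w 0 (e i) = w i := e.injective.extend_apply _ _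
    have hw0 : ∀ j, j ∉ Set.range e → Function.extend e w 0 j = 0 := fun j hj =>
      Function.extend_apply' _ _ _ (by simpa using hj)
    have hz' : ∀ i, Function.extend e z (fun _ => z₀) (e i) = z i := e.injective.extend_apply _ _
    refine ⟨(Function.extend e w 0, Function.extend e z fun _ => z₀),
      ⟨⟨fun j => ?_, ?_⟩, fun j _ => ?_⟩, ?_⟩
    · by_cases hj : j ∈ Set.range e
      · obtain ⟨i, rfl⟩ := hj
        exact (hw i).le.trans_eq (hw' i).symm
      · exact (hw0 j hj).ge
    · exact (Fintype.sum_of_injective e e.injective _ _ hw0 fun i => (hw' i).symm).symm.trans hw1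
    · by_cases hj : j ∈ Set.range e
      · obtain ⟨i, rfl⟩ := hj
        change Function.extend e z (fun _ => z₀) (e i) ∈ s
        rw [hz']
        exact hz ⟨i, rfl⟩
      · change Function.extend e z (fun _ => z₀) j ∈ s
        rw [Function.extend_apply' _ _ _ (by simpa using hj)]
        exact hz₀
    · exact (Fintype.sum_of_injective e e.injective _ _
        (fun j hj => by simp only [hw0 j hj, zero_smul]) fun i => by simp only [hw', hz']).symm
  · rintro _ ⟨⟨w, z⟩, ⟨hw, hz⟩, rfl⟩
    exact (convex_convexHull ℝ s).sum_mem (fun i _ => hw.1 i) hw.2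
      fun i _ => subset_convexHull ℝ s (hz i trivial)

/-- A bounded set of a finite-dimensional space has a small net made of its own points. -/
theorem exists_finset_net {E : Type*} [NormedAddCommGroup E] [NormedSpace ℝ E]
    [FiniteDimensional ℝ E] (S : Set E) {r ε : ℝ} (hr : 0 ≤ r) (hε : 0 < ε)
    (hS : ∀ x ∈ S, ‖x‖ ≤ r) :
    ∃ N : Finset E, (↑N ⊆ S) ∧ (∀ x ∈ S, ∃ y ∈ N, ‖x - y‖ ≤ ε) ∧
      (N.card : ℝ) ≤ (1 + 2 * r / ε) ^ Module.finrank ℝ E := by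
  classical
  -- Packing bound: balls of radius `ε/2` around separated points are disjoint and fit in a ball of
  -- radius `r + ε/2`.
  have hcard : ∀ N : Finset E, ↑N ⊆ S → (∀ x ∈ N, ∀ y ∈ N, x ≠ y → ε < ‖x - y‖) →
      (N.card : ℝ) ≤ (1 + 2 * r / ε) ^ Module.finrank ℝ E := by
    intro N hN hsep
    borelize E
    let μ : Measure E := Measure.addHaar
    have hdisj : Set.PairwiseDisjoint (N : Set E) fun c => Metric.ball c (ε / 2) := by
      intro c hc d hd hcd
      refine Metric.ball_disjoint_ball ?_
      rw [dist_eq_norm]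
      linarith [hsep c hc d hd hcd]
    have hsub : (⋃ c ∈ N, Metric.ball c (ε / 2)) ⊆ Metric.ball (0 : E) (r + ε / 2) := by
      refine Set.iUnion₂_subset fun x hx => Metric.ball_subset_ball' ?_
      rw [dist_zero_right]
      linarith [hS x (hN hx)]
    have h1 := measure_mono (μ := μ) hsub
    rw [measure_biUnion_finset hdisj fun c _ => measurableSet_ball] at h1
    simp only [μ.addHaar_ball_of_pos _ (half_pos hε),
      μ.addHaar_ball_of_pos _ (show 0 < r + ε / 2 by linarith), Finset.sum_const,
      nsmul_eq_mul, ← mul_assoc] at h1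
    have h2 := (ENNReal.mul_le_mul_iff_left (Metric.measure_ball_pos μ _ zero_lt_one).ne'
      measure_ball_lt_top.ne).1 h1
    have h3 : (N.card : ℝ) * (ε / 2) ^ Module.finrank ℝ E ≤ (r + ε / 2) ^ Module.finrank ℝ E := by
      rw [← ENNReal.ofReal_natCast, ← ENNReal.ofReal_mul (Nat.cast_nonneg _)] at h2
      exact (ENNReal.ofReal_le_ofReal_iff (by positivity)).1 h2
    have h4 : 1 + 2 * r / ε = (r + ε / 2) / (ε / 2) := by
      field_simp
      ring
    rw [h4, div_pow, le_div_iff₀ (by positivity)]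
    exact h3
  let P : ℕ → Prop := fun k => ∃ N : Finset E, ↑N ⊆ S ∧
    (∀ x ∈ N, ∀ y ∈ N, x ≠ y → ε < ‖x - y‖) ∧ N.card = k
  have hP0 : P 0 := ⟨∅, by simp, by simp, rfl⟩
  have hPb : ∀ k, P k → k ≤ ⌊(1 + 2 * r / ε) ^ Module.finrank ℝ E⌋₊ := by
    rintro _ ⟨N, hN, hsep, rfl⟩
    exact Nat.le_floor (hcard N hN hsep)
  -- A separated set of largest cardinality is a net, since a point far from all of it could be
  -- added.
  obtain ⟨N, hN, hsep, hmax⟩ := Nat.findGreatest_spec (P := P) (Nat.zero_le _) hP0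
  refine ⟨N, hN, fun x hx => ?_, hcard N hN hsep⟩
  by_contra! hfar
  have hxN : x ∉ N := fun h => by
    have := hfar x h
    rw [sub_self, norm_zero] at this
    linarith
  have hP : P (N.card + 1) := by
    refine ⟨insert x N, ?_, ?_, Finset.card_insert_of_notMem hxN⟩
    · rw [Finset.coe_insert]
      exact Set.insert_subset hx hN
    · intro a ha b hb hab
      rw [Finset.mem_insert] at ha hb
      rcases ha with rfl | ha <;> rcases hb with rfl | hb
      · exact absurd rfl hab
      · exact hfar b hb
      · rw [norm_sub_rev]
        exact hfar a ha
      · exact hsep a ha b hb hab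
  have hle : N.card + 1 ≤ Nat.findGreatest P ⌊(1 + 2 * r / ε) ^ Module.finrank ℝ E⌋₊ :=
    Nat.le_findGreatest (hPb _ hP) hP
  rw [← hmax] at hle
  exact absurd hle (Nat.not_succ_le_self _)

end Convex

/-! ### Density matrices and product states: convexity and compactness. -/

section States

variable {X A B : Type*} [Fintype X] [Fintype A] [Fintype B]

theorem convex_densityMatrices : Convex ℝ (densityMatrices X) := by
  intro ρ hρ σ hσ s t hs ht hst
  refine ⟨(hρ.1.smul hs).add (hσ.1.smul ht), ?_⟩
  rw [trace_add, trace_smul, trace_smul, hρ.2, hσ.2, ← add_smul, hst, one_smul]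

theorem kronecker_mem_densityMatrices {α : Matrix A A ℂ} {β : Matrix B B ℂ}
    (hα : α ∈ densityMatrices A) (hβ : β ∈ densityMatrices B) :
    α ⊗ₖ β ∈ densityMatrices (A × B) := by
  classical
  exact ⟨hα.1.kronecker hβ.1, by rw [trace_kronecker, hα.2, hβ.2, one_mul]⟩

theorem separableStates_subset : separableStates A B ⊆ densityMatrices (A × B) := by
  refine convexHull_min ?_ convex_densityMatrices
  rintro _ ⟨α, hα, β, hβ, rfl⟩
  exact kronecker_mem_densityMatrices hα hβ

theorem continuous_reducedState {R : Type*} [Fintype R] :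
    Continuous (reducedState : PureState (X × R) → Matrix X X ℂ) := by
  refine continuous_matrix fun x x' => ?_
  simp only [reducedState, partialTraceRight, ketbra, vecMulVec_apply]
  have h : ∀ i : X × R, Continuous fun ψ : PureState (X × R) => ψ.1 i := fun i => by fun_prop
  exact continuous_finsetSum _ fun r _ => (h (x, r)).mul (continuous_star.comp (h (x', r)))

/-- Every state has a purification. -/
theorem densityMatrices_eq_range [DecidableEq X] :
    densityMatrices X = Set.range (reducedState : PureState (X × X) → Matrix X X ℂ) := by
  refine Set.Subset.antisymm (fun ρ hρ => ?_) ?_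
  · obtain ⟨B, hB⟩ := exists_conjTranspose_mul_self hρ.1
    have hamp : amplitudes (WithLp.toLp 2 fun p : X × X => Bᴴ p.1 p.2) = Bᴴ := rfl
    have hnorm : ‖(WithLp.toLp 2 fun p : X × X => Bᴴ p.1 p.2 : EuclideanSpace ℂ (X × X))‖ = 1 := by
      rw [← sq_eq_sq₀ (norm_nonneg _) zero_le_one, ← norm_amplitudes, hamp,
        ← re_trace_conjTranspose_mul_self, conjTranspose_conjTranspose, trace_mul_comm, ← hB, hρ.2]
      simp
    refine ⟨⟨_, mem_sphere_zero_iff_norm.2 hnorm⟩, ?_⟩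
    rw [reducedState_eq, hamp, conjTranspose_conjTranspose, hB]
  · rintro _ ⟨ψ, rfl⟩
    exact reducedState_mem_densityMatrices ψ

theorem isCompact_densityMatrices : IsCompact (densityMatrices X) := by
  classical
  rw [densityMatrices_eq_range]
  exact isCompact_range continuous_reducedState

theorem isCompact_productStates : IsCompact
    {σ : Matrix (A × B) (A × B) ℂ | ∃ α ∈ densityMatrices A, ∃ β ∈ densityMatrices B,
      σ = α ⊗ₖ β} := by
  have h : Continuous fun p : Matrix A A ℂ × Matrix B B ℂ => p.1 ⊗ₖ p.2 := by
    refine continuous_matrix fun i j => ?_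
    simp only [kroneckerMap_apply]
    exact (continuous_fst.matrix_elem _ _).mul (continuous_snd.matrix_elem _ _)
  convert (isCompact_densityMatrices.prod isCompact_densityMatrices).image h using 1
  ext σ
  constructor
  · rintro ⟨α, hα, β, hβ, rfl⟩
    exact ⟨(α, β), ⟨hα, hβ⟩, rfl⟩
  · rintro ⟨⟨α, β⟩, ⟨hα, hβ⟩, rfl⟩
    exact ⟨α, hα, β, hβ, rfl⟩

theorem inv_card_smul_one_mem_densityMatrices [DecidableEq X] [Nonempty X] :
    ((Fintype.card X : ℝ)⁻¹ • (1 : Matrix X X ℂ)) ∈ densityMatrices X := by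
  refine ⟨PosSemidef.one.smul (by positivity), ?_⟩
  rw [trace_smul, trace_one, Complex.real_smul]
  push_cast
  exact inv_mul_cancel₀ (by simp)

theorem IsHermitian.trace_mul_im {O ρ : Matrix X X ℂ} (hO : O.IsHermitian) (hρ : ρ.IsHermitian) :
    (O * ρ).trace.im = 0 := by
  have h : star (O * ρ).trace = (O * ρ).trace := by
    rw [← trace_conjTranspose, conjTranspose_mul, hO.eq, hρ.eq, trace_mul_comm]
  exact Complex.conj_eq_iff_im.1 h

end States

/-! ### The Frobenius norm of block-positive operators. -/

section BlockPositive

variable {A B : Type*} [Fintype A] [Fintype B]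

/-- Operators with nonnegative expectation in every product state. -/
def IsBlockPositive (W : Matrix (A × B) (A × B) ℂ) : Prop :=
  ∀ α ∈ densityMatrices A, ∀ β ∈ densityMatrices B, 0 ≤ (W * (α ⊗ₖ β)).trace.re

theorem exists_density_smul {X : Type*} [Fintype X] (a : X → ℂ) :
    vecMulVec a (star a) = 0 ∨ ∃ r : ℝ, 0 < r ∧ ∃ α ∈ densityMatrices X,
      vecMulVec a (star a) = r • α := by
  have hpsd := posSemidef_vecMulVec_self_star a
  have hre : ((vecMulVec a (star a)).trace.re : ℂ) = (vecMulVec a (star a)).trace := by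
    have := Complex.le_def.1 hpsd.trace_nonneg
    exact Complex.ext (by simp) (by simpa using this.2)
  have hnn : 0 ≤ (vecMulVec a (star a)).trace.re := (Complex.le_def.1 hpsd.trace_nonneg).1
  rcases hnn.eq_or_lt with h0 | hpos
  · left
    rw [← hpsd.trace_eq_zero_iff, ← hre, ← h0, Complex.ofReal_zero]
  · right
    refine ⟨_, hpos, (vecMulVec a (star a)).trace.re⁻¹ • vecMulVec a (star a),
      ⟨hpsd.smul (inv_nonneg.2 hnn), ?_⟩, ?_⟩
    · rw [trace_smul, Complex.real_smul, Complex.ofReal_inv, hre]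
      refine inv_mul_cancel₀ fun h => hpos.ne' ?_
      rw [h, Complex.zero_re]
    · rw [smul_smul, mul_inv_cancel₀ hpos.ne', one_smul]

theorem IsBlockPositive.vector_nonneg {W : Matrix (A × B) (A × B) ℂ} (hW : IsBlockPositive W)
    (a : A → ℂ) (b : B → ℂ) :
    0 ≤ (W * (vecMulVec a (star a) ⊗ₖ vecMulVec b (star b))).trace.re := by
  rcases exists_density_smul a with ha | ⟨r, hr, α, hα, ha⟩
  · simp [ha]
  rcases exists_density_smul b with hb | ⟨s, hs, β, hβ, hb⟩
  · simp [hb]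
  rw [ha, hb, smul_kronecker, kronecker_smul, smul_smul, mul_smul_comm, trace_smul,
    Complex.smul_re]
  exact mul_nonneg (mul_pos hr hs).le (hW α hα β hβ)

/-- The `(i, j)` block of an operator on `ℂ^A ⊗ ℂ^B`. -/
def block (W : Matrix (A × B) (A × B) ℂ) (i j : A) : Matrix B B ℂ := fun k l => W (i, k) (j, l)

theorem trace_mul_product_eq (W : Matrix (A × B) (A × B) ℂ) (a : A → ℂ) (b : B → ℂ) :
    (W * (vecMulVec a (star a) ⊗ₖ vecMulVec b (star b))).trace =
      ∑ i, ∑ j, star (a i) * a j * (star b ⬝ᵥ block W i j *ᵥ b) := by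
  simp only [trace, diag_apply, mul_apply, Fintype.sum_prod_type, kroneckerMap_apply,
    vecMulVec_apply, dotProduct, mulVec, block, Finset.mul_sum, Pi.star_apply]
  refine Finset.sum_congr rfl fun i _ => ?_
  rw [Finset.sum_comm]
  refine Finset.sum_congr rfl fun j _ => Finset.sum_congr rfl fun k _ =>
    Finset.sum_congr rfl fun l _ => by ring

theorem block_conjTranspose {A B : Type*} {W : Matrix (A × B) (A × B) ℂ} (hW : W.IsHermitian) (i j : A) :
    (block W i j)ᴴ = block W j i := by
  ext k l
  exact hW.apply (j, k) (i, l)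

theorem star_dotProduct_conjTranspose_mulVec (X : Matrix B B ℂ) (b : B → ℂ) :
    star b ⬝ᵥ Xᴴ *ᵥ b = star (star b ⬝ᵥ X *ᵥ b) := by
  rw [star_dotProduct, star_mulVec, conjTranspose_conjTranspose, ← dotProduct_mulVec]

/-- Evaluates `W` at the product vector `(x eᵢ + t eⱼ) ⊗ b`. The outcome is a quadratic in the real
variable `x`, whose discriminant then gives a Cauchy–Schwarz inequality between blocks. -/
theorem IsBlockPositive.two_term [DecidableEq A] {W : Matrix (A × B) (A × B) ℂ}
    (hW : IsBlockPositive W) (hH : W.IsHermitian) (b : B → ℂ) (i j : A) (x : ℝ) (t : ℂ) :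
    0 ≤ x ^ 2 * (star b ⬝ᵥ block W i i *ᵥ b).re +
      2 * x * (t * (star b ⬝ᵥ block W i j *ᵥ b)).re +
      Complex.normSq t * (star b ⬝ᵥ block W j j *ᵥ b).re := by
  have h := hW.vector_nonneg (Pi.single i (x : ℂ) + Pi.single j t) b
  rw [trace_mul_product_eq] at h
  simp only [Pi.add_apply, Pi.single_apply, star_add, add_mul, mul_add, Finset.sum_add_distrib,
    apply_ite star, star_zero, ite_mul, zero_mul, mul_ite, mul_zero, Finset.sum_ite_eq',
    Finset.mem_univ, if_true] at h
  rw [← block_conjTranspose hH i j, star_dotProduct_conjTranspose_mulVec] at h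
  have : ∀ z p q w : ℂ, (star (x : ℂ) * x * p + star t * x * star z +
      (star (x : ℂ) * t * z + star t * t * q)).re =
      x ^ 2 * p.re + 2 * x * (t * z).re + Complex.normSq t * q.re := by
    intro z p q w
    simp [Complex.normSq_apply]
    ring
  rw [← this _ _ _ 0]
  convert h using 2

theorem IsBlockPositive.diag_nonneg {W : Matrix (A × B) (A × B) ℂ}
    (hW : IsBlockPositive W) (hH : W.IsHermitian) (b : B → ℂ) (i : A) :
    0 ≤ (star b ⬝ᵥ block W i i *ᵥ b).re := by
  classical
  simpa using hW.two_term hH b i i 1 0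

theorem IsBlockPositive.sq_le {W : Matrix (A × B) (A × B) ℂ}
    (hW : IsBlockPositive W) (hH : W.IsHermitian) (b : B → ℂ) (i j : A) (t : ℂ)
    (ht : Complex.normSq t = 1) :
    (t * (star b ⬝ᵥ block W i j *ᵥ b)).re ^ 2 ≤
      (star b ⬝ᵥ block W i i *ᵥ b).re * (star b ⬝ᵥ block W j j *ᵥ b).re := by
  classical
  have h := discrim_le_zero (a := (star b ⬝ᵥ block W i i *ᵥ b).re)
    (b := 2 * (t * (star b ⬝ᵥ block W i j *ᵥ b)).re)
    (c := (star b ⬝ᵥ block W j j *ᵥ b).re) fun x => by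
      have := hW.two_term hH b i j x t
      rw [ht] at this
      linarith
  rw [discrim] at h
  linarith

open scoped Matrix.Norms.Frobenius

theorem norm_block_sq_sum (W : Matrix (A × B) (A × B) ℂ) :
    ‖W‖ ^ 2 = ∑ i, ∑ j, ‖block W i j‖ ^ 2 := by
  simp only [frobenius_norm_sq, Fintype.sum_prod_type, block]
  exact Finset.sum_congr rfl fun i _ => Finset.sum_comm

/-- Off-diagonal blocks are not Hermitian; this recovers the norm of `X` from the Hermitian parts of
`X` and `iX`. -/
theorem norm_smul_add_conjTranspose_sq (X : Matrix B B ℂ) :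
    ‖X + Xᴴ‖ ^ 2 + ‖Complex.I • X + (Complex.I • X)ᴴ‖ ^ 2 = 4 * ‖X‖ ^ 2 := by
  have h : ∀ x y : ℂ, ‖x + star y‖ ^ 2 + ‖Complex.I * x + star (Complex.I * y)‖ ^ 2 =
      2 * ‖x‖ ^ 2 + 2 * ‖y‖ ^ 2 := by
    intro x y
    simp only [Complex.sq_norm, Complex.normSq_apply]
    simp
    ring
  have h2 : ∑ i, ∑ j, ‖X j i‖ ^ 2 = ‖X‖ ^ 2 := by
    rw [frobenius_norm_sq, Finset.sum_comm]
  rw [frobenius_norm_sq, frobenius_norm_sq, ← Finset.sum_add_distrib]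
  simp only [← Finset.sum_add_distrib, Matrix.add_apply, conjTranspose_apply, Matrix.smul_apply,
    smul_eq_mul, h]
  simp only [Finset.sum_add_distrib, ← Finset.mul_sum, h2, ← frobenius_norm_sq]
  ring

/-- For a phase `t`, the Hermitian matrix `tWᵢⱼ + (tWᵢⱼ)ᴴ` has numerical values dominated by the
geometric means of those of `2Wᵢᵢ` and `2Wⱼⱼ`, so `IsHermitian.norm_sq_le_of_sq_le` applies. The
phases `1` and `i` together control the whole block, at the price of the factor `2`. -/
theorem IsBlockPositive.norm_block_sq_le {W : Matrix (A × B) (A × B) ℂ}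
    (hW : IsBlockPositive W) (hH : W.IsHermitian) (i j : A) :
    ‖block W i j‖ ^ 2 ≤ 2 * ((block W i i).trace.re * (block W j j).trace.re) := by
  classical
  have key : ∀ t : ℂ, Complex.normSq t = 1 →
      ‖t • block W i j + (t • block W i j)ᴴ‖ ^ 2 ≤
        4 * ((block W i i).trace.re * (block W j j).trace.re) := by
    intro t ht
    have hHerm : (t • block W i j + (t • block W i j)ᴴ).IsHermitian :=
      isHermitian_add_transpose_self _
    have h2 : ∀ (Y : Matrix B B ℂ) (b : B → ℂ),
        (star b ⬝ᵥ ((2 : ℝ) • Y) *ᵥ b).re = 2 * (star b ⬝ᵥ Y *ᵥ b).re := fun Y b => by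
      rw [smul_mulVec, dotProduct_smul, Complex.smul_re, smul_eq_mul]
    have := IsHermitian.norm_sq_le_of_sq_le hHerm (P := (2 : ℝ) • block W i i)
      (Q := (2 : ℝ) • block W j j)
      (fun b => by rw [h2]; linarith [hW.diag_nonneg hH b i])
      (fun b => by rw [h2]; linarith [hW.diag_nonneg hH b j])
      fun b => by
        rw [h2, h2, add_mulVec, dotProduct_add, star_dotProduct_conjTranspose_mulVec,
          smul_mulVec, dotProduct_smul, smul_eq_mul, Complex.add_re, Complex.star_def,
          Complex.conj_re]
        nlinarith [hW.sq_le hH b i j t ht]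
    rw [trace_smul, trace_smul, Complex.smul_re, Complex.smul_re, smul_eq_mul, smul_eq_mul] at this
    linarith
  have h1 := key 1 (by simp)
  have h2 := key Complex.I (by simp)
  rw [one_smul] at h1
  have h3 := norm_smul_add_conjTranspose_sq (block W i j)
  linarith

/-- The Frobenius norm of a block-positive operator is at most `√2` times its trace. -/
theorem IsBlockPositive.norm_sq_le {W : Matrix (A × B) (A × B) ℂ}
    (hW : IsBlockPositive W) (hH : W.IsHermitian) : ‖W‖ ^ 2 ≤ 2 * W.trace.re ^ 2 := by
  have htr : W.trace.re = ∑ i, (block W i i).trace.re := by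
    simp [trace, Fintype.sum_prod_type, block]
  rw [norm_block_sq_sum, htr, sq (∑ i, _), Finset.sum_mul_sum, Finset.mul_sum]
  refine Finset.sum_le_sum fun i _ => ?_
  rw [Finset.mul_sum]
  exact Finset.sum_le_sum fun j _ => hW.norm_block_sq_le hH i j

end BlockPositive

/-! ### Entanglement witnesses from Hahn–Banach separation. -/

section Witness

variable {A B : Type*} [Fintype A] [Fintype B]

/-- A state whose feasible region contains no separable state is detected by a witness in the
linear span of the observables and the identity. -/
theorem exists_witness [DecidableEq A] [DecidableEq B] [Nonempty A] [Nonempty B] {M : ℕ}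
    {O : Fin M → Matrix (A × B) (A × B) ℂ} (hO : ∀ i, (O i).IsHermitian)
    {ρ : Matrix (A × B) (A × B) ℂ} (hρ : ρ ∈ densityMatrices (A × B))
    (h : feasibleRegion O ρ ∩ separableStates A B = ∅) :
    ∃ W ∈ Submodule.span ℝ (Set.range (Fin.cons 1 O : Fin (M + 1) → Matrix (A × B) (A × B) ℂ)),
      IsBlockPositive W ∧ W.trace.re = 1 ∧ (W * ρ).trace.re ≤ 0 := by
  set S := {σ : Matrix (A × B) (A × B) ℂ | ∃ α ∈ densityMatrices A, ∃ β ∈ densityMatrices B,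
    σ = α ⊗ₖ β} with hSdef
  -- Separating in the space of expectation values, rather than of matrices, is what places the
  -- witness in the span of the observables. Real parts lose nothing, since the expectations of
  -- Hermitian observables in states are real.
  let L : Matrix (A × B) (A × B) ℂ →ₗ[ℝ] (Fin M → ℝ) :=
    { toFun := fun σ i => (O i * σ).trace.re
      map_add' := fun σ τ => by ext i; simp [mul_add]
      map_smul' := fun r σ => by ext i; simp }
  have hL : Continuous L := by
    refine continuous_pi fun i => Complex.continuous_re.comp ?_
    exact (continuous_const.matrix_mul continuous_id).matrix_trace
  have hclosed : IsClosed (convexHull ℝ (L '' S)) :=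
    (isCompact_convexHull (isCompact_productStates.image hL)).isClosed
  have hnot : L ρ ∉ convexHull ℝ (L '' S) := by
    rw [← LinearMap.image_convexHull]
    rintro ⟨σ, hσ, hσρ⟩
    have hmem : σ ∈ feasibleRegion O ρ ∩ separableStates A B := by
      have hσ' := separableStates_subset hσ
      refine ⟨⟨hσ', fun i => Complex.ext (congrFun hσρ i) ?_⟩, hσ⟩
      rw [IsHermitian.trace_mul_im (hO i) hσ'.1.1, IsHermitian.trace_mul_im (hO i) hρ.1.1]
    rw [h] at hmem
    exact hmem
  obtain ⟨f, u, hfρ, hfS⟩ := geometric_hahn_banach_point_closed (convex_convexHull ℝ _) hclosed hnot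
  set W₀ : Matrix (A × B) (A × B) ℂ :=
    ∑ i, f (Pi.single i 1) • O i - u • (1 : Matrix (A × B) (A × B) ℂ) with hW₀
  have heval : ∀ σ : Matrix (A × B) (A × B) ℂ, σ.trace = 1 →
      (W₀ * σ).trace.re = f (L σ) - u := by
    intro σ hσ
    have hf : f (L σ) = ∑ i, f (Pi.single i 1) * (O i * σ).trace.re := by
      conv_lhs => rw [pi_eq_sum_univ' (L σ)]
      rw [map_sum]
      refine Finset.sum_congr rfl fun i _ => ?_
      rw [map_smul, smul_eq_mul, mul_comm]
      congr 2
    rw [hf, hW₀, sub_mul, Finset.sum_mul, trace_sub, trace_sum, Complex.sub_re, Complex.re_sum]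
    congr 1
    · refine Finset.sum_congr rfl fun i _ => ?_
      rw [smul_mul_assoc, trace_smul, Complex.smul_re, smul_eq_mul]
    · rw [smul_mul_assoc, one_mul, trace_smul, Complex.smul_re, hσ]
      simp
  have hpos : ∀ α ∈ densityMatrices A, ∀ β ∈ densityMatrices B,
      0 < (W₀ * (α ⊗ₖ β)).trace.re := by
    intro α hα β hβ
    rw [heval _ (kronecker_mem_densityMatrices hα hβ).2, sub_pos]
    exact hfS _ (subset_convexHull ℝ _ ⟨_, ⟨α, hα, β, hβ, rfl⟩, rfl⟩)
  -- The maximally mixed state is a product state, so strict positivity there allows normalising the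
  -- trace to one.
  have htr : 0 < W₀.trace.re := by
    have := hpos _ (inv_card_smul_one_mem_densityMatrices (X := A)) _
      (inv_card_smul_one_mem_densityMatrices (X := B))
    rw [smul_kronecker, kronecker_smul, smul_smul, one_kronecker_one, mul_smul_comm, mul_one,
      trace_smul, Complex.smul_re] at this
    exact pos_of_mul_pos_right this (by positivity)
  have hmem : W₀ ∈ Submodule.span ℝ
      (Set.range (Fin.cons 1 O : Fin (M + 1) → Matrix (A × B) (A × B) ℂ)) := by
    refine sub_mem (sum_mem fun i _ => Submodule.smul_mem _ _ (Submodule.subset_span ⟨i.succ, ?_⟩))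
      (Submodule.smul_mem _ _ (Submodule.subset_span ⟨0, ?_⟩)) <;> simp
  refine ⟨W₀.trace.re⁻¹ • W₀, Submodule.smul_mem _ _ hmem, fun α hα β hβ => ?_, ?_, ?_⟩
  · rw [smul_mul_assoc, trace_smul, Complex.smul_re]
    exact mul_nonneg (inv_nonneg.2 htr.le) (hpos α hα β hβ).le
  · rw [trace_smul, Complex.smul_re, smul_eq_mul, inv_mul_cancel₀ htr.ne']
  · rw [smul_mul_assoc, trace_smul, Complex.smul_re, smul_eq_mul, heval _ hρ.2]
    exact mul_nonpos_of_nonneg_of_nonpos (inv_nonneg.2 htr.le) (by linarith)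

theorem isHermitian_of_mem_span {A B : Type*} [DecidableEq A] [DecidableEq B] {M : ℕ}
    {O : Fin M → Matrix (A × B) (A × B) ℂ} (hO : ∀ i, (O i).IsHermitian)
    {W : Matrix (A × B) (A × B) ℂ}
    (hW : W ∈ Submodule.span ℝ
      (Set.range (Fin.cons 1 O : Fin (M + 1) → Matrix (A × B) (A × B) ℂ))) : W.IsHermitian := by
  have hle : Submodule.span ℝ
      (Set.range (Fin.cons 1 O : Fin (M + 1) → Matrix (A × B) (A × B) ℂ)) ≤
      selfAdjoint.submodule ℝ (Matrix (A × B) (A × B) ℂ) := by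
    rw [Submodule.span_le]
    rintro _ ⟨i, rfl⟩
    refine Fin.cases ?_ (fun i => ?_) i
    · exact isHermitian_one
    · exact hO i
  exact hle hW

end Witness

/-! ### Detection probability of single-copy criteria. -/

section Capability

open scoped Matrix.Norms.Frobenius

theorem norm_le_one_of_mem_densityMatrices {X : Type*} [Fintype X] [DecidableEq X]
    {ρ : Matrix X X ℂ} (hρ : ρ ∈ densityMatrices X) : ‖ρ‖ ≤ 1 := by
  obtain ⟨B, rfl⟩ := exists_conjTranspose_mul_self hρ.1
  refine (frobenius_norm_mul _ _).trans ?_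
  rw [frobenius_norm_conjTranspose, ← sq, ← re_trace_conjTranspose_mul_self, hρ.2]
  simp

theorem measurable_trace_mul_re {X : Type*} [Fintype X] (V : Matrix X X ℂ) :
    Measurable fun ρ : Matrix X X ℂ => (V * ρ).trace.re := by
  have hentry : ∀ i j : X, Measurable fun ρ : Matrix X X ℂ => ρ i j := fun i j =>
    (measurable_pi_apply j).comp (measurable_pi_apply (X := fun _ : X => X → ℂ) i)
  simp only [trace, diag_apply, mul_apply]
  exact Complex.measurable_re.comp (Finset.measurable_sum _ fun i _ =>
    Finset.measurable_sum _ fun j _ => (hentry j i).const_mul _)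

theorem inducedDist_trace_le {X R : Type*} [Fintype X] [Fintype R] [DecidableEq X] [DecidableEq R]
    [Nonempty X] [Nonempty R] {V : Matrix X X ℂ} (hV : V.PosDef) :
    inducedDist X R {ρ | (V * ρ).trace.re ≤ 1} ≤
      ENNReal.ofReal ((V.det.re ^ Fintype.card R)⁻¹) := by
  rw [inducedDist, Measure.map_apply measurable_reducedState
    (measurableSet_le (measurable_trace_mul_re V) measurable_const)]
  exact uniformPureState_trace_le hV

theorem IsHermitian.real_smul {X : Type*} {A : Matrix X X ℂ} (hA : A.IsHermitian) (r : ℝ) :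
    (r • A).IsHermitian := by
  rw [IsHermitian, conjTranspose_smul, star_trivial, hA.eq]

/-- A fixed normalised witness has, even up to an error of `1 / (2 d)`, an exponentially small
detection probability. -/
theorem inducedDist_witness_le {X R : Type*} [Fintype X] [Fintype R] [DecidableEq X]
    [DecidableEq R] [Nonempty X] [Nonempty R] {W : Matrix X X ℂ} (hW : W.IsHermitian)
    (htr : W.trace.re = 1) (hnorm : ‖W‖ ^ 2 ≤ 2) :
    inducedDist X R {ρ | ρ.trace = 1 ∧ (W * ρ).trace.re ≤ 1 / (2 * Fintype.card X)} ≤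
      ENNReal.ofReal (Real.exp (-(Fintype.card R / 64))) := by
  have hd : (0 : ℝ) < Fintype.card X := by exact_mod_cast Fintype.card_pos
  set ε : ℝ := 1 / (2 * Fintype.card X) with hε
  -- The shift absorbs the slack: on trace-one `ρ` the event becomes `tr (Yρ) ≤ 0`, while half of
  -- the trace of `W` survives because `ε d = 1/2`.
  set Y : Matrix X X ℂ := W - ε • (1 : Matrix X X ℂ) with hY
  have hYH : Y.IsHermitian := hW.sub (IsHermitian.real_smul isHermitian_one ε)
  have hYtr : Y.trace.re = 1 / 2 := by
    rw [hY, trace_sub, trace_smul, trace_one, Complex.sub_re, Complex.smul_re, htr, hε]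
    simp
    field_simp
    norm_num
  have hYnorm : ‖Y‖ ^ 2 ≤ 2 := by
    have : Y * Y = W * W - (2 * ε) • W + (ε ^ 2) • 1 := by
      rw [hY, sub_mul, mul_sub, mul_sub]
      simp only [smul_mul_assoc, mul_smul_comm, one_mul, mul_one, smul_smul, two_mul, add_smul, sq]
      abel
    rw [← IsHermitian.re_trace_mul_self hYH, this, trace_add, trace_sub, trace_smul, trace_smul,
      trace_one, Complex.add_re, Complex.sub_re, Complex.smul_re, Complex.smul_re, htr,
      IsHermitian.re_trace_mul_self hW]
    have h1 : ε ^ 2 * Fintype.card X = ε / 2 := by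
      rw [hε]; field_simp
    have h2 : 0 < ε := by positivity
    simp
    linarith
  -- With factor `1/16`, `tr (V - 1) = 1/32` and `2‖V - 1‖² ≤ 1/64`, so the first-order term wins
  -- and `log det V ≥ 1/64`.
  set V : Matrix X X ℂ := 1 + (1 / 16 : ℝ) • Y with hV
  have hV1 : V - 1 = (1 / 16 : ℝ) • Y := by rw [hV]; abel
  have hVnorm : ‖V - 1‖ ^ 2 ≤ 1 / 128 := by
    rw [hV1, norm_smul, mul_pow]
    norm_num
    linarith
  have hVH : V.IsHermitian := isHermitian_one.add (IsHermitian.real_smul hYH _)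
  obtain ⟨hpd, hdet⟩ := IsHermitian.exp_le_det hVH (by linarith)
  have hexp : Real.exp (1 / 64) ≤ V.det.re := by
    refine le_trans (Real.exp_le_exp.2 ?_) hdet
    have : (V - 1).trace.re = 1 / 32 := by
      rw [hV1, trace_smul, Complex.smul_re, hYtr]; norm_num
    linarith
  refine (measure_mono ?_).trans ((inducedDist_trace_le (R := R) hpd).trans ?_)
  · rintro ρ ⟨hρ, hρW⟩
    change (V * ρ).trace.re ≤ 1
    rw [hV, hY, add_mul, smul_mul_assoc, sub_mul, smul_mul_assoc, one_mul, trace_add, trace_smul,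
      trace_sub, trace_smul, hρ, Complex.add_re, Complex.smul_re, Complex.sub_re, Complex.smul_re]
    simp only [Complex.one_re, smul_eq_mul, mul_one]
    linarith
  · refine ENNReal.ofReal_le_ofReal ?_
    rw [Real.exp_neg]
    refine inv_anti₀ (Real.exp_pos _) ?_
    calc Real.exp (Fintype.card R / 64) = Real.exp (1 / 64) ^ Fintype.card R := by
          rw [← Real.exp_nat_mul]; ring_nf
      _ ≤ _ := by gcongr

/-- Union bound over a net of witnesses. -/
theorem singleCopyCapability_le {A B R : Type*} [Fintype A] [Fintype B] [Fintype R] [DecidableEq A]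
    [DecidableEq B] [DecidableEq R] [Nonempty A] [Nonempty B] [Nonempty R] {M : ℕ}
    {O : Fin M → Matrix (A × B) (A × B) ℂ} (hO : ∀ i, (O i).IsHermitian) :
    singleCopyCapability R O ≤
      (1 + 8 * (Fintype.card (A × B) : ℝ)) ^ (M + 1) * Real.exp (-(Fintype.card R / 64)) := by
  set d : ℝ := (Fintype.card (A × B) : ℝ) with hd
  have hdpos : 0 < d := by rw [hd]; exact_mod_cast Fintype.card_pos
  set E := Submodule.span ℝ
    (Set.range (Fin.cons 1 O : Fin (M + 1) → Matrix (A × B) (A × B) ℂ)) with hE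
  have hrank : Module.finrank ℝ E ≤ M + 1 := by
    exact (finrank_range_le_card (R := ℝ)
      (Fin.cons 1 O : Fin (M + 1) → Matrix (A × B) (A × B) ℂ)).trans_eq (Fintype.card_fin _)
  set S : Set E := {W | IsBlockPositive W.1 ∧ W.1.trace.re = 1} with hS
  have hbd : ∀ W ∈ S, ‖W.1‖ ^ 2 ≤ 2 := fun W hW => by
    have := hW.1.norm_sq_le (isHermitian_of_mem_span hO W.2)
    rw [hW.2] at this
    linarith
  obtain ⟨N, hNS, hcov, hcard⟩ := exists_finset_net S (r := 2) (ε := 1 / (2 * d)) (by norm_num)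
    (by positivity) fun W hW => by
      have h2 : ‖W‖ ^ 2 ≤ 2 ^ 2 := (hbd W hW).trans (by norm_num)
      exact abs_le_of_sq_le_sq' h2 (by norm_num) |>.2
  have hcard' : (N.card : ℝ) ≤ (1 + 8 * d) ^ (M + 1) := by
    refine hcard.trans ?_
    have : 1 + 2 * 2 / (1 / (2 * d)) = 1 + 8 * d := by field_simp; ring
    rw [this]
    exact pow_le_pow_right₀ (by linarith) hrank
  have hae : ∀ᵐ ρ ∂inducedDist (A × B) R, ρ ∈ densityMatrices (A × B) := by
    have hmeas : MeasurableSet (densityMatrices (A × B)) := by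
      have : BorelSpace (Matrix (A × B) (A × B) ℂ) :=
        inferInstanceAs (BorelSpace (A × B → A × B → ℂ))
      exact isCompact_densityMatrices.isClosed.measurableSet
    exact (ae_map_iff measurable_reducedState.aemeasurable hmeas).2
      (Filter.Eventually.of_forall reducedState_mem_densityMatrices)
  -- States have Frobenius norm at most one, so replacing `W` by a net point within `1/(2d)` moves
  -- its expectation by at most `1/(2d)`. Measurability of the detected set is never needed: only
  -- monotonicity of the measure is used.
  have hsub : ({ρ | feasibleRegion O ρ ∩ separableStates A B = ∅} : Set _)
      ≤ᵐ[inducedDist (A × B) R] ⋃ W ∈ N, {ρ | ρ.trace = 1 ∧ (W.1 * ρ).trace.re ≤ 1 / (2 * d)} := by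
    filter_upwards [hae] with ρ hρ hdet
    obtain ⟨W, hWE, hWbp, hWtr, hWρ⟩ := exists_witness hO hρ hdet
    obtain ⟨W', hW'N, hWW'⟩ := hcov ⟨W, hWE⟩ ⟨hWbp, hWtr⟩
    refine Set.mem_iUnion₂.2 ⟨W', hW'N, hρ.2, ?_⟩
    have h1 : ‖W - W'.1‖ ≤ 1 / (2 * d) := hWW'
    have h2 : ((W'.1 - W) * ρ).trace.re ≤ 1 / (2 * d) := by
      refine (Complex.re_le_norm _).trans ((norm_trace_mul_le _ _).trans ?_)
      rw [norm_sub_rev]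
      exact (mul_le_of_le_one_right (norm_nonneg _) (norm_le_one_of_mem_densityMatrices hρ)).trans h1
    rw [sub_mul, trace_sub, Complex.sub_re] at h2
    linarith
  have hmeas : inducedDist (A × B) R {ρ | feasibleRegion O ρ ∩ separableStates A B = ∅} ≤
      ENNReal.ofReal ((1 + 8 * d) ^ (M + 1) * Real.exp (-(Fintype.card R / 64))) := by
    calc _ ≤ _ := measure_mono_ae hsub
      _ ≤ ∑ W ∈ N, inducedDist (A × B) R
          {ρ | ρ.trace = 1 ∧ (W.1 * ρ).trace.re ≤ 1 / (2 * d)} := measure_biUnion_finset_le _ _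
      _ ≤ ∑ W ∈ N, ENNReal.ofReal (Real.exp (-(Fintype.card R / 64))) :=
          Finset.sum_le_sum fun W hW => inducedDist_witness_le (isHermitian_of_mem_span hO W.2)
            (hNS hW).2 (hbd W (hNS hW))
      _ = ENNReal.ofReal (N.card * Real.exp (-(Fintype.card R / 64))) := by
          rw [Finset.sum_const, nsmul_eq_mul, ENNReal.ofReal_mul (Nat.cast_nonneg _),
            ENNReal.ofReal_natCast]
      _ ≤ _ := ENNReal.ofReal_le_ofReal (by gcongr)
  exact ENNReal.toReal_le_of_le_ofReal (by positivity) hmeas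

/-- Excludes `M = 0`, so that `M + 1 ≤ 2M` in the final estimate. -/
theorem singleCopyCapability_zero {A B R : Type*} [Fintype A] [Fintype B] [Fintype R]
    [DecidableEq A] [DecidableEq B] [Nonempty A] [Nonempty B]
    (O : Fin 0 → Matrix (A × B) (A × B) ℂ) : singleCopyCapability R O = 0 := by
  have h : {ρ | feasibleRegion O ρ ∩ separableStates A B = ∅} = ∅ := by
    refine Set.eq_empty_of_forall_notMem fun ρ hρ => ?_
    have hσ : _ ∈ separableStates A B := subset_convexHull ℝ _
      ⟨_, inv_card_smul_one_mem_densityMatrices, _, inv_card_smul_one_mem_densityMatrices, rfl⟩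
    have : _ ∈ feasibleRegion O ρ ∩ separableStates A B :=
      ⟨⟨separableStates_subset hσ, fun i => i.elim0⟩, hσ⟩
    rw [hρ] at this
    exact this
  rw [singleCopyCapability, h, measureReal_empty]

theorem observables_lower_bound {n : ℕ} (hn : 2 ≤ n) {M : ℕ}
    {O : Fin M → Matrix (Fin n × Fin n) (Fin n × Fin n) ℂ} (hO : ∀ i, (O i).IsHermitian)
    (hcap : 1 / 2 < singleCopyCapability (Fin n) O) :
    1 / 1000 * (n / Real.log n) ≤ M := by
  have : NeZero n := ⟨by omega⟩
  have hM : 1 ≤ M := by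
    rcases Nat.eq_zero_or_pos M with rfl | h
    · rw [singleCopyCapability_zero] at hcap
      norm_num at hcap
    · exact h
  have hM' : (1 : ℝ) ≤ M := by exact_mod_cast hM
  have hn' : (2 : ℝ) ≤ n := by exact_mod_cast hn
  have hlog2 : 1 / 2 < Real.log 2 := by linarith [Real.log_two_gt_d9]
  have hlog : Real.log 2 ≤ Real.log n := Real.log_le_log (by norm_num) hn'
  rw [← mul_div_assoc, div_le_iff₀ (by linarith)]
  have h1 := hcap.trans_le (singleCopyCapability_le (R := Fin n) hO)
  have h2 : Real.log (1 / 2) < (M + 1) * Real.log (1 + 8 * (n : ℝ) ^ 2) - n / 64 := by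
    have := Real.log_lt_log (by norm_num) h1
    rw [Real.log_mul (by positivity) (by positivity), Real.log_pow, Real.log_exp] at this
    simp only [Fintype.card_prod, Fintype.card_fin] at this
    push_cast at this
    rw [sq]
    linarith
  -- For `n ≥ 2`, `n⁶ ≥ 16 n² ≥ 1 + 8n²`.
  have h3 : Real.log (1 + 8 * (n : ℝ) ^ 2) ≤ 6 * Real.log n := by
    rw [← Real.log_rpow (by positivity)]
    refine Real.log_le_log (by positivity) ?_
    norm_cast
    have : 2 ^ 4 ≤ n ^ 4 := Nat.pow_le_pow_left hn 4
    nlinarith [sq_nonneg n, Nat.pow_le_pow_left hn 2]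
  have h4 : Real.log (1 / 2) = - Real.log 2 := by rw [one_div, Real.log_inv]
  rw [h4] at h2
  have h5 : ((M : ℝ) + 1) * Real.log (1 + 8 * (n : ℝ) ^ 2) ≤ (2 * M) * (6 * Real.log n) := by
    gcongr
    · exact Real.log_nonneg (by nlinarith)
    · linarith
  -- Now `n/64 < 12 M log n + log 2 ≤ 13 M log n`, and `13 · 64 = 832 ≤ 1000`.
  nlinarith [mul_le_mul_of_nonneg_right hM' (show 0 ≤ Real.log n by linarith)]

end Capability

/-! ### The swap observable and the purity criterion. -/

section PurityObservable

variable {A B : Type*} [Fintype A] [Fintype B] [DecidableEq A] [DecidableEq B]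

theorem trace_swapAB_mul (ρ σ : Matrix (A × B) (A × B) ℂ) :
    (swapAB A B * (ρ ⊗ₖ σ)).trace = (ρ * σ).trace := by
  simp only [trace, diag_apply, mul_apply, swapAB, ite_mul, one_mul, zero_mul]
  rw [Finset.sum_comm]
  simp only [Finset.sum_ite_eq', Finset.mem_univ, if_true]
  rw [Fintype.sum_prod_type]
  simp only [kroneckerMap_apply]

theorem trace_swapA_mul (ρ σ : Matrix (A × B) (A × B) ℂ) :
    (swapA A B * (ρ ⊗ₖ σ)).trace = (partialTraceRight ρ * partialTraceRight σ).trace := by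
  simp only [trace, diag_apply, mul_apply, swapA, ite_mul, one_mul, zero_mul]
  rw [Finset.sum_comm]
  simp only [Finset.sum_ite_eq', Finset.mem_univ, if_true, kroneckerMap_apply, partialTraceRight,
    Fintype.sum_prod_type, Finset.sum_mul_sum]
  exact Finset.sum_congr rfl fun a _ => Finset.sum_comm

theorem purityObservable_isHermitian {A B : Type*} [DecidableEq A] [DecidableEq B] :
    (purityObservable A B).IsHermitian := by
  refine IsHermitian.sub ?_ ?_
  · ext p q
    simp only [conjTranspose_apply, swapAB, apply_ite star, star_one, star_zero]
    congr 1
    rw [eq_iff_iff]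
    constructor <;> rintro rfl <;> rfl
  · ext p q
    simp only [conjTranspose_apply, swapA, apply_ite star, star_one, star_zero]
    congr 1
    simp only [Prod.ext_iff, eq_iff_iff]
    constructor <;> rintro ⟨⟨h1, h2⟩, h3, h4⟩ <;>
      exact ⟨⟨h3.symm, h2.symm⟩, h1.symm, h4.symm⟩

theorem trace_purityObservable_mul (ρ σ : Matrix (A × B) (A × B) ℂ) :
    (purityObservable A B * (ρ ⊗ₖ σ)).trace =
      (ρ * σ).trace - (partialTraceRight ρ * partialTraceRight σ).trace := by
  rw [purityObservable, sub_mul, trace_sub, trace_swapAB_mul, trace_swapA_mul]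

theorem twoCopyExpectation_purityObservable (ρ : Matrix (A × B) (A × B) ℂ) :
    twoCopyExpectation (purityObservable A B) ρ =
      (ρ ^ 2).trace - ((partialTraceRight ρ) ^ 2).trace := by
  rw [twoCopyExpectation, trace_purityObservable_mul, sq, sq]

theorem partialTraceRight_kronecker {A B : Type*} [Fintype B] (α : Matrix A A ℂ)
    (β : Matrix B B ℂ) : partialTraceRight (α ⊗ₖ β) = β.trace • α := by
  ext a a'
  simp [partialTraceRight, trace, ← Finset.mul_sum, mul_comm]

open scoped Matrix.Norms.Frobenius in
theorem exists_trace_mul_eq_ofReal {X : Type*} [Fintype X] {α β : Matrix X X ℂ}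
    (hα : α ∈ densityMatrices X) (hβ : β ∈ densityMatrices X) :
    ∃ r : ℝ, 0 ≤ r ∧ r ≤ 1 ∧ (α * β).trace = r := by
  classical
  obtain ⟨C, hC⟩ := exists_conjTranspose_mul_self hα.1
  obtain ⟨D, hD⟩ := exists_conjTranspose_mul_self hβ.1
  have h1 : (α * β).trace.re = ‖C * Dᴴ‖ ^ 2 := by
    rw [← re_trace_conjTranspose_mul_self, conjTranspose_mul, conjTranspose_conjTranspose, hC, hD,
      Matrix.mul_assoc D, trace_mul_comm D]
    simp only [Matrix.mul_assoc]
  refine ⟨(α * β).trace.re, h1 ▸ sq_nonneg _, ?_, Complex.ext rfl ?_⟩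
  · refine (Complex.re_le_norm _).trans ((norm_trace_mul_le _ _).trans ?_)
    exact mul_le_one₀ (norm_le_one_of_mem_densityMatrices hα) (norm_nonneg _)
      (norm_le_one_of_mem_densityMatrices hβ)
  · exact IsHermitian.trace_mul_im hα.1.1 hβ.1.1

theorem trace_purityObservable_product_nonpos {α α' : Matrix A A ℂ} {β β' : Matrix B B ℂ}
    (hα : α ∈ densityMatrices A) (hβ : β ∈ densityMatrices B)
    (hα' : α' ∈ densityMatrices A) (hβ' : β' ∈ densityMatrices B) :
    (purityObservable A B * ((α ⊗ₖ β) ⊗ₖ (α' ⊗ₖ β'))).trace.re ≤ 0 := by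
  obtain ⟨r, hr0, -, hr⟩ := exists_trace_mul_eq_ofReal hα hα'
  obtain ⟨s, -, hs1, hs⟩ := exists_trace_mul_eq_ofReal hβ hβ'
  rw [trace_purityObservable_mul, partialTraceRight_kronecker, partialTraceRight_kronecker, hβ.2,
    hβ'.2, one_smul, one_smul, ← mul_kronecker_mul, trace_kronecker, hr, hs]
  norm_cast
  nlinarith

/-- The expectation is quadratic in `σ`, so its sublevel set need not be convex. The two copies are
therefore treated as independent arguments, and convexity is used in one at a time. -/
theorem twoCopyExpectation_separable_nonpos {σ : Matrix (A × B) (A × B) ℂ}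
    (hσ : σ ∈ separableStates A B) :
    (twoCopyExpectation (purityObservable A B) σ).re ≤ 0 := by
  have hleft : ∀ τ : Matrix (A × B) (A × B) ℂ, Convex ℝ
      {ρ | (purityObservable A B * (ρ ⊗ₖ τ)).trace.re ≤ 0} := fun τ =>
    convex_halfSpace_le ⟨fun x y => by rw [add_kronecker, mul_add, trace_add, Complex.add_re],
      fun c x => by rw [smul_kronecker, mul_smul_comm, trace_smul, Complex.smul_re]⟩ 0
  have hright : ∀ τ : Matrix (A × B) (A × B) ℂ, Convex ℝ
      {ρ | (purityObservable A B * (τ ⊗ₖ ρ)).trace.re ≤ 0} := fun τ =>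
    convex_halfSpace_le ⟨fun x y => by rw [kronecker_add, mul_add, trace_add, Complex.add_re],
      fun c x => by rw [kronecker_smul, mul_smul_comm, trace_smul, Complex.smul_re]⟩ 0
  have h1 : ∀ α ∈ densityMatrices A, ∀ β ∈ densityMatrices B,
      separableStates A B ⊆ {ρ | (purityObservable A B * (ρ ⊗ₖ (α ⊗ₖ β))).trace.re ≤ 0} := by
    intro α hα β hβ
    refine convexHull_min ?_ (hleft _)
    rintro _ ⟨α', hα', β', hβ', rfl⟩
    exact trace_purityObservable_product_nonpos hα' hβ' hα hβ
  have h2 : separableStates A B ⊆ {ρ | (purityObservable A B * (σ ⊗ₖ ρ)).trace.re ≤ 0} := by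
    refine convexHull_min ?_ (hright _)
    rintro _ ⟨α, hα, β, hβ, rfl⟩
    exact h1 α hα β hβ hσ
  exact h2 hσ

end PurityObservable

/-! ### Homogeneous functions on the sphere: null zero sets and sign symmetry. -/

section Cone

open scoped Pointwise

variable {E : Type*} [NormedAddCommGroup E] [NormedSpace ℝ E] [FiniteDimensional ℝ E]
  [MeasurableSpace E] [BorelSpace E]

/-- The zero set of a nonzero homogeneous real-analytic function is a null set. -/
theorem addHaar_zeroSet_of_homogeneous (μ : Measure E) [μ.IsAddHaarMeasure] {f : E → ℝ}
    (hf : ∀ x, AnalyticAt ℝ f x) (k : ℕ) (hk : ∀ (t : ℝ) x, f (t • x) = t ^ k * f x) {v : E}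
    (hv : f v ≠ 0) : μ {x | f x = 0} = 0 := by
  have hcont : Continuous f := continuous_iff_continuousAt.2 fun x => (hf x).continuousAt
  have hline : ∀ y, ∀ᵐ t : ℝ, f (y + t • v) ≠ 0 := by
    intro y
    have han : AnalyticOnNhd ℝ (fun t : ℝ => f (y + t • v)) Set.univ := fun t _ =>
      (hf _).comp_of_eq (by fun_prop) rfl
    obtain ⟨t, ht⟩ : ∃ t : ℝ, f (y + t • v) ≠ 0 := by
      -- If `f` vanished on the whole line `y + ℝv`, homogeneity would make it vanish at `v + s y`
      -- for all `s ≠ 0`; letting `s → 0` contradicts `f v ≠ 0`.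
      by_contra! hzero
      have h1 : ∀ s : ℝ, s ≠ 0 → f (v + s • y) = 0 := fun s hs => by
        have : v + s • y = s • (y + s⁻¹ • v) := by
          -- Rescaling turns a point of the line through `y` in direction `v` into a point near `v`.
          rw [smul_add, smul_smul, mul_inv_cancel₀ hs, one_smul, add_comm]
        rw [this, hk, hzero, mul_zero]
      have h2 : Filter.Tendsto (fun s : ℝ => f (v + s • y)) (nhdsWithin 0 {0}ᶜ) (nhds (f v)) := by
        have : Continuous fun s : ℝ => f (v + s • y) := by fun_prop
        simpa using (this.tendsto 0).mono_left nhdsWithin_le_nhds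
      have h3 : Filter.Tendsto (fun s : ℝ => f (v + s • y)) (nhdsWithin 0 {0}ᶜ) (nhds 0) :=
        tendsto_const_nhds.congr' (by
          filter_upwards [self_mem_nhdsWithin] with s hs using (h1 s hs).symm)
      exact hv (tendsto_nhds_unique h2 h3)
    have h := han.preimage_zero_mem_codiscrete ht
    have h' := ae_restrict_le_codiscreteWithin (μ := (volume : Measure ℝ)) MeasurableSet.univ h
    rw [Measure.restrict_univ] at h'
    exact h'
  have hmeas : MeasurableSet {x | f x ≠ 0} := (isOpen_ne_fun hcont continuous_const).measurableSet
  -- Fubini along the lines parallel to `v`: a nonzero analytic function of one real variable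
  -- vanishes only on a null set.
  have := ae_mem_of_ae_add_linearMap_mem (LinearMap.toSpanSingleton ℝ E v) volume μ hmeas
    (by simpa using hline)
  simpa [ae_iff] using this

theorem Ioo_smul_image_sphere {E : Type*} [NormedAddCommGroup E] [NormedSpace ℝ E] {p : E → Prop} (hp : ∀ r : ℝ, 0 < r → ∀ x, p (r • x) ↔ p x)
    (h0 : ¬ p 0) :
    Set.Ioo (0 : ℝ) 1 • ((↑) '' {ψ : Metric.sphere (0 : E) 1 | p ψ}) =
      {x | x ∈ Metric.ball (0 : E) 1 ∧ p x} := by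
  ext x
  constructor
  · rintro ⟨r, hr, _, ⟨ψ, hψ, rfl⟩, rfl⟩
    refine ⟨?_, (hp r hr.1 _).2 hψ⟩
    simpa [norm_smul, abs_of_pos hr.1] using hr.2
  · rintro ⟨hx, hpx⟩
    have hx0 : x ≠ 0 := fun h => h0 (h ▸ hpx)
    have hpos : 0 < ‖x‖ := norm_pos_iff.2 hx0
    refine ⟨‖x‖, ⟨hpos, by simpa using hx⟩, ‖x‖⁻¹ • x, ⟨⟨‖x‖⁻¹ • x, ?_⟩, ?_, rfl⟩, ?_⟩
    · simp [norm_smul, hpos.ne']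
    · exact (hp _ (inv_pos.2 hpos) x).2 hpx
    · simp [smul_smul, hpos.ne']

/-- A continuous homogeneous function that is odd under an isometric involution and almost never
zero is positive on exactly half of the sphere. -/
theorem toSphere_pos_eq_toSphere_neg (μ : Measure E) [μ.IsAddHaarMeasure] {f : E → ℝ}
    (hf : Continuous f) {k : ℕ} (hk0 : k ≠ 0) (hk : ∀ (t : ℝ) x, f (t • x) = t ^ k * f x)
    (T : E →ₗ[ℝ] E) (hnorm : ∀ x, ‖T x‖ = ‖x‖) (hT : ∀ x, T (T x) = x)
    (hodd : ∀ x, f (T x) = - f x) :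
    μ.toSphere {ψ | 0 < f ψ} = μ.toSphere {ψ | f ψ < 0} := by
  have hf0 : f 0 = 0 := by simpa [hk0] using hk 0 0
  have hm1 : MeasurableSet {ψ : Metric.sphere (0 : E) 1 | 0 < f ψ} :=
    (isOpen_lt continuous_const (hf.comp continuous_subtype_val)).measurableSet
  have hm2 : MeasurableSet {ψ : Metric.sphere (0 : E) 1 | f ψ < 0} :=
    (isOpen_lt (hf.comp continuous_subtype_val) continuous_const).measurableSet
  -- An involution has determinant `±1`, so it preserves volume; it carries the positive part of the
  -- ball onto the negative part.
  have hdet : LinearMap.det T * LinearMap.det T = 1 := by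
    rw [← LinearMap.det_comp, show T ∘ₗ T = LinearMap.id from LinearMap.ext hT, LinearMap.det_id]
  have hdet0 : LinearMap.det T ≠ 0 := left_ne_zero_of_mul_eq_one hdet
  have habs : |(LinearMap.det T)⁻¹| = 1 := by
    rw [inv_eq_of_mul_eq_one_left hdet]
    rcases mul_self_eq_one_iff.1 hdet with h | h <;> simp [h]
  rw [Measure.toSphere_apply' _ hm1, Measure.toSphere_apply' _ hm2,
    Ioo_smul_image_sphere (p := fun x => 0 < f x)
      (fun r hr x => by rw [hk]; exact mul_pos_iff_of_pos_left (pow_pos hr k)) (by simp [hf0]),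
    Ioo_smul_image_sphere (p := fun x => f x < 0)
      (fun r hr x => by rw [hk, ← smul_eq_mul]; exact smul_neg_iff_of_pos_left (pow_pos hr k)) (by simp [hf0])]
  congr 1
  have h := Measure.addHaar_preimage_linearMap μ hdet0 {x | x ∈ Metric.ball (0 : E) 1 ∧ f x < 0}
  rw [habs, ENNReal.ofReal_one, one_mul] at h
  rw [← h]
  congr 1
  ext x
  simp [hnorm, hodd]

theorem toSphere_zeroSet {E : Type*} [NormedAddCommGroup E] [NormedSpace ℝ E]
    [MeasurableSpace E] [BorelSpace E] (μ : Measure E) {f : E → ℝ}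
    (hf : Continuous f) {k : ℕ} (hk : ∀ (t : ℝ) x, f (t • x) = t ^ k * f x)
    (h0 : μ {x | f x = 0} = 0) : μ.toSphere {ψ | f ψ = 0} = 0 := by
  have hm : MeasurableSet {ψ : Metric.sphere (0 : E) 1 | f ψ = 0} :=
    (isClosed_eq (hf.comp continuous_subtype_val) continuous_const).measurableSet
  rw [Measure.toSphere_apply' _ hm]
  refine mul_eq_zero_of_right _ (measure_mono_null ?_ h0)
  rintro _ ⟨r, -, _, ⟨ψ, hψ, rfl⟩, rfl⟩
  change f (r • (ψ : E)) = 0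
  rw [hk, show f ψ = 0 from hψ, mul_zero]

end Cone

theorem uniformPureState_pos_eq_half {ι : Type*} [Fintype ι] [Nonempty ι]
    {f : EuclideanSpace ℂ ι → ℝ} (hf : ∀ x, AnalyticAt ℝ f x) {k : ℕ} (hk0 : k ≠ 0)
    (hk : ∀ (t : ℝ) x, f (t • x) = t ^ k * f x)
    (T : EuclideanSpace ℂ ι →ₗ[ℝ] EuclideanSpace ℂ ι) (hnorm : ∀ x, ‖T x‖ = ‖x‖)
    (hT : ∀ x, T (T x) = x) (hodd : ∀ x, f (T x) = - f x) {v : EuclideanSpace ℂ ι}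
    (hv : f v ≠ 0) : (uniformPureState ι).real {ψ | 0 < f ψ.1} = 1 / 2 := by
  have hcont : Continuous f := continuous_iff_continuousAt.2 fun x => (hf x).continuousAt
  have h1 : (uniformPureState ι).real {ψ | 0 < f ψ.1} =
      (uniformPureState ι).real {ψ | f ψ.1 < 0} := by
    rw [measureReal_def, measureReal_def, uniformPureState, Measure.smul_apply, Measure.smul_apply,
      toSphere_pos_eq_toSphere_neg _ hcont hk0 hk T hnorm hT hodd]
  have h2 : (uniformPureState ι).real {ψ | f ψ.1 = 0} = 0 := by
    rw [measureReal_def, uniformPureState, Measure.smul_apply,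
      toSphere_zeroSet _ hcont hk (addHaar_zeroSet_of_homogeneous _ hf k hk hv), smul_zero,
      ENNReal.toReal_zero]
  have hc : Continuous fun ψ : PureState ι => f ψ.1 := hcont.comp continuous_subtype_val
  have hm2 : MeasurableSet {ψ : PureState ι | f ψ.1 < 0} :=
    (isOpen_lt hc continuous_const).measurableSet
  have hm3 : MeasurableSet {ψ : PureState ι | f ψ.1 = 0} :=
    (isClosed_eq hc continuous_const).measurableSet
  have huniv : (Set.univ : Set (PureState ι)) =
      ({ψ | 0 < f ψ.1} ∪ {ψ | f ψ.1 < 0}) ∪ {ψ | f ψ.1 = 0} := by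
    ext ψ
    rcases lt_trichotomy (f ψ.1) 0 with h | h | h <;> simp [h]
  have h3 : (uniformPureState ι).real Set.univ = 1 := probReal_univ
  rw [huniv, measureReal_union _ hm3, measureReal_union _ hm2, h2, ← h1] at h3
  · linarith
  · exact Set.disjoint_left.2 fun ψ (ha : 0 < f ψ.1) (hb : f ψ.1 < 0) => lt_asymm ha hb
  · refine Set.disjoint_left.2 fun ψ ha (hb : f ψ.1 = 0) => ?_
    rcases ha with (ha : 0 < f ψ.1) | (ha : f ψ.1 < 0)
    · exact ha.ne' hb
    · exact ha.ne hb

/-! ### The purity gap of a tripartite pure state and its sign change. -/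

section PurityGap

variable {A B R : Type*} [Fintype A] [Fintype B] [Fintype R]

/-- The difference of the purities of the marginals on `AB` and on `A` of a tripartite vector. -/
def purityGap (x : EuclideanSpace ℂ ((A × B) × R)) : ℝ :=
  (∑ p : A × B, ∑ q : A × B, (∑ r, x (p, r) * star (x (q, r))) * (∑ r, x (q, r) * star (x (p, r))) -
    ∑ a : A, ∑ a' : A, (∑ b : B, ∑ r, x ((a, b), r) * star (x ((a', b), r))) *
      (∑ b : B, ∑ r, x ((a', b), r) * star (x ((a, b), r)))).re

theorem analyticAt_purityGap (x : EuclideanSpace ℂ ((A × B) × R)) :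
    AnalyticAt ℝ (purityGap : EuclideanSpace ℂ ((A × B) × R) → ℝ) x := by
  have hcoord : ∀ i, AnalyticAt ℝ (fun x : EuclideanSpace ℂ ((A × B) × R) => x i) x := fun i =>
    ((EuclideanSpace.proj i : EuclideanSpace ℂ ((A × B) × R) →L[ℂ] ℂ).restrictScalars ℝ).analyticAt x
  have hstar : ∀ i, AnalyticAt ℝ (fun x : EuclideanSpace ℂ ((A × B) × R) => star (x i)) x :=
    fun i => AnalyticAt.comp (g := fun z : ℂ => star z) (f := fun x : EuclideanSpace ℂ ((A × B) × R) => x i)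
      ((Complex.conjCLE : ℂ →L[ℝ] ℂ).analyticAt _) (hcoord i)
  have hmul : ∀ i j, AnalyticAt ℝ
      (fun x : EuclideanSpace ℂ ((A × B) × R) => x i * star (x j)) x :=
    fun i j => (hcoord i).mul (hstar j)
  unfold purityGap
  refine AnalyticAt.comp (g := Complex.re) (Complex.reCLM.analyticAt _) ?_
  refine AnalyticAt.fun_sub ?_ ?_
  · refine Finset.analyticAt_fun_sum _ fun p _ => ?_
    refine Finset.analyticAt_fun_sum _ fun q _ => ?_
    refine AnalyticAt.fun_mul ?_ ?_ <;>
      exact Finset.analyticAt_fun_sum _ fun r _ => hmul _ _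
  · refine Finset.analyticAt_fun_sum _ fun a _ => ?_
    refine Finset.analyticAt_fun_sum _ fun a' _ => ?_
    refine AnalyticAt.fun_mul ?_ ?_ <;>
    · refine Finset.analyticAt_fun_sum _ fun b _ => ?_
      exact Finset.analyticAt_fun_sum _ fun r _ => hmul _ _

theorem purityGap_smul (t : ℝ) (x : EuclideanSpace ℂ ((A × B) × R)) :
    purityGap (t • x) = t ^ 4 * purityGap x := by
  have h : ∀ i j, (t • x) i * star ((t • x) j) = (t : ℂ) ^ 2 * (x i * star (x j)) := fun i j => by
    simp
    ring
  have h2 : ∀ y z : ℂ, (t : ℂ) ^ 2 * y * ((t : ℂ) ^ 2 * z) = ((t ^ 4 : ℝ) : ℂ) * (y * z) :=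
    fun y z => by push_cast; ring
  simp only [purityGap, h, ← Finset.mul_sum, h2, ← mul_sub, Complex.re_ofReal_mul]

theorem twoCopyExpectation_reducedState [DecidableEq A] [DecidableEq B]
    (ψ : PureState ((A × B) × R)) :
    (twoCopyExpectation (purityObservable A B) (reducedState ψ)).re = purityGap ψ.1 := by
  rw [twoCopyExpectation_purityObservable, purityGap, sq, sq]
  simp only [trace, diag_apply, mul_apply, reducedState, partialTraceRight, ketbra,
    vecMulVec_apply]

/-- The unitary exchanging the systems `A` and `R` of `A ⊗ B ⊗ A`. -/
def exchange (A B : Type*) [Fintype A] [Fintype B] :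
    EuclideanSpace ℂ ((A × B) × A) ≃ₗᵢ[ℂ] EuclideanSpace ℂ ((A × B) × A) :=
  LinearIsometryEquiv.piLpCongrLeft 2 ℂ ℂ
    { toFun := fun p => ((p.2, p.1.2), p.1.1)
      invFun := fun p => ((p.2, p.1.2), p.1.1)
      left_inv := fun _ => rfl
      right_inv := fun _ => rfl }

theorem exchange_apply (x : EuclideanSpace ℂ ((A × B) × A)) (a : A) (b : B) (r : A) :
    exchange A B x ((a, b), r) = x ((r, b), a) := rfl

/-- A pure state has the same purity on `AB` as on the complementary system. -/
theorem purity_exchange (x : EuclideanSpace ℂ ((A × B) × A)) :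
    ∑ p : A × B, ∑ q : A × B, (∑ r, exchange A B x (p, r) * star (exchange A B x (q, r))) *
        (∑ r, exchange A B x (q, r) * star (exchange A B x (p, r))) =
      ∑ a : A, ∑ a' : A, (∑ b : B, ∑ r, x ((a, b), r) * star (x ((a', b), r))) *
        (∑ b : B, ∑ r, x ((a', b), r) * star (x ((a, b), r))) := by
  -- Reshaping `x` across the cut between `A` and the rest reduces the identity to `tr (N Nᴴ)² = tr
  -- (Nᴴ N)²`.
  obtain ⟨N, hN⟩ : ∃ N : Matrix A (B × A) ℂ, ∀ a b r, N a (b, r) = x ((a, b), r) :=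
    ⟨fun a p => x ((a, p.1), p.2), fun _ _ _ => rfl⟩
  have h1 : ∑ a : A, ∑ a' : A, (∑ b : B, ∑ r, x ((a, b), r) * star (x ((a', b), r))) *
        (∑ b : B, ∑ r, x ((a', b), r) * star (x ((a, b), r))) = (N * Nᴴ * (N * Nᴴ)).trace := by
    simp only [trace, diag_apply, mul_apply, conjTranspose_apply, Fintype.sum_prod_type, hN]
  have h2 : (N * Nᴴ * (N * Nᴴ)).trace = (Nᴴ * N * (Nᴴ * N)).trace := by
    rw [Matrix.mul_assoc N, trace_mul_comm N]
    simp only [Matrix.mul_assoc]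
  rw [h1, h2]
  simp only [trace, diag_apply, mul_apply, conjTranspose_apply]
  refine Fintype.sum_equiv (Equiv.prodComm A B) _ _ fun p =>
    Fintype.sum_equiv (Equiv.prodComm A B) _ _ fun q => ?_
  rw [mul_comm]
  obtain ⟨a, b⟩ := p
  obtain ⟨a', b'⟩ := q
  simp only [hN, exchange_apply, Equiv.prodComm_apply, Prod.swap]
  congr 1 <;> exact Finset.sum_congr rfl fun r _ => mul_comm _ _

theorem purityGap_exchange (x : EuclideanSpace ℂ ((A × B) × A)) :
    purityGap (exchange A B x) = - purityGap x := by
  have h := purity_exchange (exchange A B x)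
  rw [show exchange A B (exchange A B x) = x from rfl] at h
  rw [purityGap, purityGap, purity_exchange, h, ← Complex.neg_re, neg_sub]

/-- An unnormalised two-level Bell pair on `AB`, tensored with a basis vector of `R`, is pure on
`AB` but mixed on `A`: the gap is `4 - 2`. -/
theorem exists_purityGap_ne_zero [Nontrivial A] [Nontrivial B] [Nonempty R] :
    ∃ x : EuclideanSpace ℂ ((A × B) × R), purityGap x ≠ 0 := by
  classical
  obtain ⟨a₀, a₁, ha⟩ := exists_pair_ne A
  obtain ⟨b₀, b₁, hb⟩ := exists_pair_ne B
  obtain ⟨r₀⟩ := ‹Nonempty R›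
  let s : A → ℂ := fun a => if a = a₀ then 1 else 0
  let t : A → ℂ := fun a => if a = a₁ then 1 else 0
  let s' : B → ℂ := fun b => if b = b₀ then 1 else 0
  let t' : B → ℂ := fun b => if b = b₁ then 1 else 0
  let e : R → ℂ := fun r => if r = r₀ then 1 else 0
  obtain ⟨u, hu⟩ : ∃ u : A × B → ℂ, ∀ a b, u (a, b) = s a * s' b + t a * t' b :=
    ⟨fun p => s p.1 * s' p.2 + t p.1 * t' p.2, fun _ _ => rfl⟩
  have hustar : ∀ p, star (u p) = u p := fun p => by
    rw [← Prod.mk.eta (p := p), hu]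
    simp only [s, t, s', t']
    split_ifs <;> simp
  have he : ∑ r, e r * star (e r) = 1 := by simp [e]
  have hB : ∀ c₁ c₂ c₃ c₄ : ℂ, ∑ b, (c₁ * s' b + c₂ * t' b) * (c₃ * s' b + c₄ * t' b) =
      c₁ * c₃ + c₂ * c₄ := fun c₁ c₂ c₃ c₄ => by
    simp [s', t', mul_add, add_mul, Finset.sum_add_distrib, hb, hb.symm]
  have hA : ∑ a, (s a * s a + t a * t a) = 2 := by
    simp [s, t, Finset.sum_add_distrib, one_add_one_eq_two]
  have hA2 : ∑ a, ∑ a', (s a * s a' + t a * t a') * (s a' * s a + t a' * t a) = 2 := by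
    simp [s, t, mul_add, Finset.sum_add_distrib, ha, ha.symm, one_add_one_eq_two]
  have hfac : ∀ p q, ∑ r, u p * e r * star (u q * e r) = u p * u q := fun p q => by
    rw [← mul_one (u p * u q), ← he, Finset.mul_sum]
    refine Finset.sum_congr rfl fun r _ => ?_
    rw [star_mul', hustar]
    ring
  have h1 : ∑ p, ∑ q, u p * u q * (u q * u p) = 4 := by
    have : ∑ p, u p * u p = 2 := by
      rw [Fintype.sum_prod_type, ← hA]
      refine Finset.sum_congr rfl fun a _ => ?_
      simp only [hu, hB]
    calc _ = (∑ p, u p * u p) * ∑ q, u q * u q := by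
          rw [Finset.sum_mul_sum]
          exact Finset.sum_congr rfl fun p _ => Finset.sum_congr rfl fun q _ => by ring
      _ = 4 := by rw [this]; norm_num
  have h2 : ∀ a a', ∑ b, u (a, b) * u (a', b) = s a * s a' + t a * t a' := fun a a' => by
    simp only [hu, hB]
  refine ⟨WithLp.toLp 2 fun p => u p.1 * e p.2, ?_⟩
  simp only [purityGap, hfac, h1, h2, hA2]
  norm_num

theorem twoCopyCapability_purityObservable [DecidableEq A] [DecidableEq B] [Nontrivial A]
    [Nontrivial B] : twoCopyCapability A (purityObservable A B) = 1 / 2 := by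
  obtain ⟨v, hv⟩ := exists_purityGap_ne_zero (A := A) (B := B) (R := A)
  have hmeas : MeasurableSet {ρ : Matrix (A × B) (A × B) ℂ |
      0 < (twoCopyExpectation (purityObservable A B) ρ).re} := by
    have hentry : ∀ i j : A × B, Measurable fun ρ : Matrix (A × B) (A × B) ℂ => ρ i j := fun i j =>
      (measurable_pi_apply j).comp (measurable_pi_apply (X := fun _ : A × B => A × B → ℂ) i)
    refine measurableSet_lt measurable_const (Complex.measurable_re.comp ?_)
    unfold twoCopyExpectation
    simp only [trace, diag_apply, mul_apply, kroneckerMap_apply]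
    exact Finset.measurable_sum _ fun i _ => Finset.measurable_sum _ fun j _ =>
      ((hentry _ _).mul (hentry _ _)).const_mul _
  rw [twoCopyCapability, inducedDist, map_measureReal_apply measurable_reducedState hmeas]
  simp only [Set.preimage_ofPred_eq, twoCopyExpectation_reducedState]
  exact uniformPureState_pos_eq_half analyticAt_purityGap (by norm_num) purityGap_smul
    ((exchange A B).toLinearEquiv.toLinearMap.restrictScalars ℝ)
    (fun x => (exchange A B).norm_map x) (fun x => rfl) purityGap_exchange hv

end PurityGap

end

end EntDetect

theorem mainTheorem4 :
    -- Single-copy criteria: `Ω(√d / ln d)` observables are needed for capability above `1/2`.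
    (∃ c : ℝ, 0 < c ∧ ∀ d n : ℕ, 2 ≤ n → d = n ^ 2 →
      ∀ (M : ℕ) (O : Fin M → Matrix (Fin n × Fin n) (Fin n × Fin n) ℂ),
        (∀ i, (O i).IsHermitian) →
        1 / 2 < EntDetect.singleCopyCapability (Fin n) O →
        c * (Real.sqrt d / Real.log d) ≤ M) ∧
    -- Two-copy criterion: the single observable `𝕊_AB - 𝕊_A` measures `Tr ρ² - Tr ρ_A²`, is
    -- nonpositive on every separable state, and detects with capability exactly `1/2`.
    (∀ n : ℕ, 2 ≤ n →
      (EntDetect.purityObservable (Fin n) (Fin n)).IsHermitian ∧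
      (∀ ρ : Matrix (Fin n × Fin n) (Fin n × Fin n) ℂ,
        EntDetect.twoCopyExpectation (EntDetect.purityObservable (Fin n) (Fin n)) ρ =
          (ρ ^ 2).trace - ((EntDetect.partialTraceRight ρ) ^ 2).trace) ∧
      (∀ σ ∈ EntDetect.separableStates (Fin n) (Fin n),
        (EntDetect.twoCopyExpectation (EntDetect.purityObservable (Fin n) (Fin n)) σ).re ≤ 0) ∧
      EntDetect.twoCopyCapability (Fin n) (EntDetect.purityObservable (Fin n) (Fin n)) = 1 / 2) := by
  -- Twice the constant `1/1000`, because `log d = 2 log n`.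
  refine ⟨⟨1 / 500, by norm_num, fun d n hn hd M O hO hcap => ?_⟩, fun n hn => ?_⟩
  · subst hd
    have h := EntDetect.observables_lower_bound hn hO hcap
    push_cast
    rw [Real.sqrt_sq (Nat.cast_nonneg n), Real.log_pow, Nat.cast_ofNat, ← div_div,
      div_right_comm]
    linarith
  · have : Nontrivial (Fin n) := Fin.nontrivial_iff_two_le.2 hn
    exact ⟨EntDetect.purityObservable_isHermitian, EntDetect.twoCopyExpectation_purityObservable,
      fun σ hσ => EntDetect.twoCopyExpectation_separable_nonpos hσ,
      EntDetect.twoCopyCapability_purityObservable⟩
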